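/- A \emph{weight function} is a continuous non-decreasing function $\omega:[0,\infty)\to[0,\infty)$ with $\omega\equiv 0$ on $[0,1]$ such that, as $t\to\infty$, $(\alpha)$ $\omega(2t)=O(\omega(t))$, $(\beta)$ $\omega(t)=O(t)$, $(\gamma)$ $\log t=o(\omega(t))$, and such that $(\delta)$ $\psi:[0,\infty)\to[0,\infty)$, $\psi(x)=\omega(e^x)$, is convex. Put $\psi^*(y)=\sup_{x\ge 0}(xy-\psi(x))$ for $y\ge 0$. For $n\in\mathbb Z_+$ let $\mathcal D_{L^1,\omega,n}(\mathbb R^d)$ be the space of all $\varphi\in C^\infty(\mathbb R^d)$ (complex-valued) such that $\varphi^{(\alpha)}\in L^1(\mathbb R^d)$ for all $\alpha\in\mathbb N^d$ and $$\|\varphi\|_{\mathcal D_{L^1,\omega,n}}=\sup_{\alpha\in\mathbb N^d}\|\varphi^{(\alpha)}\|_{L^1}\exp\Bigl(-\frac1n\psi^*(n|\alpha|)\Bigr)<\infty ,$$ normed by this quantity. Let $\mathcal D_{L^1,\{\omega\}}(\mathbb R^d)=\bigcup_{n}\mathcal D_{L^1,\omega,n}(\mathbb R^d)$ carry the locally convex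 inductive limit topology, and let $\mathcal B'_{\{\omega\}}(\mathbb R^d)$ be its dual, i.e. the space of continuous linear functionals $\mathcal D_{L^1,\{\omega\}}(\mathbb R^d)\to\mathbb C$. If $\sigma$ is another weight function with $\sigma(t)=O(\omega(t))$, then $\mathcal D_{L^1,\{\omega\}}(\mathbb R^d)\subseteq\mathcal D_{L^1,\{\sigma\}}(\mathbb R^d)$. \textbf{Theorem.} Let $\omega$ be a weight function. For every $f\in\mathcal B'_{\{\omega\}}(\mathbb R^d)$ there are a weight function $\sigma$ with $\sigma(t)=o(\omega(t))$ as $t\to\infty$ and a functional $g\in\mathcal B'_{\{\sigma\}}(\mathbb R^d)$ such that $g_{|\mathcal D_{L^1,\{\omega\}}(\mathbb R^d)}=f$. -/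

import Mathlib

open MeasureTheory Filter Asymptotics

noncomputable section

/-- A weight function `ω : [0,∞) → [0,∞)`. It is represented by a function on `ℝ` of which only the
values on `[0,∞)` matter; non-negativity there follows from `monotone'` and `zero'`. -/
structure WeightFunction where
  /-- the underlying function -/
  toFun : ℝ → ℝ
  continuous' : ContinuousOn toFun (Set.Ici 0)
  monotone' : MonotoneOn toFun (Set.Ici 0)
  zero' : ∀ t ∈ Set.Icc (0 : ℝ) 1, toFun t = 0
  /-- condition `(α)` -/
  alpha : (fun t => toFun (2 * t)) =O[atTop] toFun
  /-- condition `(β)` -/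
  beta : toFun =O[atTop] (fun t : ℝ => t)
  /-- condition `(γ)` -/
  gamma : Real.log =o[atTop] toFun
  /-- condition `(δ)` -/
  delta : ConvexOn ℝ (Set.Ici 0) (fun x => toFun (Real.exp x))

namespace WeightFunction

instance : CoeFun WeightFunction (fun _ => ℝ → ℝ) := ⟨toFun⟩

variable (ω σ : WeightFunction)

/-- `ψ(x) = ω(eˣ)`. -/
def psi (x : ℝ) : ℝ := ω (Real.exp x)

/-- The Young conjugate `ψ*(y) = sup_{x ≥ 0} (x y - ψ(x))`. -/
def psiStar (y : ℝ) : ℝ := ⨆ x : Set.Ici (0 : ℝ), ((x : ℝ) * y - ω.psi x)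

theorem nonneg {t : ℝ} (ht : 0 ≤ t) : 0 ≤ ω t := by
  have h := ω.monotone' (Set.mem_Ici.2 le_rfl) (Set.mem_Ici.2 ht) ht
  rwa [ω.zero' 0 ⟨le_rfl, zero_le_one⟩] at h

theorem psi_nonneg (x : ℝ) : 0 ≤ ω.psi x := ω.nonneg (Real.exp_pos x).le

/-- The supremum that defines `ψ*(y)` is finite. -/
theorem bddAbove_psiStar (y : ℝ) :
    BddAbove (Set.range fun x : Set.Ici (0 : ℝ) => (x : ℝ) * y - ω.psi x) := by
  have h1 := ω.gamma.def (c := 1 / (|y| + 1)) (by positivity)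
  obtain ⟨X, hX⟩ := eventually_atTop.1 (Real.tendsto_exp_atTop.eventually h1)
  refine ⟨|X| * |y|, ?_⟩
  rintro _ ⟨⟨x, hx⟩, rfl⟩
  have hx : 0 ≤ x := hx
  have h0 := ω.psi_nonneg x
  have hxy : x * y ≤ x * |y| := mul_le_mul_of_nonneg_left (le_abs_self y) hx
  rcases le_total X x with h | h
  · have h2 := hX x h
    rw [Real.log_exp, Real.norm_of_nonneg hx, Real.norm_of_nonneg (ω.nonneg (Real.exp_pos x).le),
      one_div, inv_mul_eq_div, le_div_iff₀ (by positivity)] at h2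
    have h3 : x * (|y| + 1) ≤ ω.psi x := h2
    have : 0 ≤ |X| * |y| := by positivity
    simp only
    nlinarith
  · have : x * |y| ≤ |X| * |y| :=
      mul_le_mul_of_nonneg_right (h.trans (le_abs_self X)) (abs_nonneg y)
    simp only
    linarith

theorem le_psiStar {x : ℝ} (hx : 0 ≤ x) (y : ℝ) : x * y - ω.psi x ≤ ω.psiStar y :=
  le_ciSup (ω.bddAbove_psiStar y) (⟨x, hx⟩ : Set.Ici (0 : ℝ))

variable {ω σ}

/-- If `σ = O(ω)`, then `ψ_ω*(n y) / n ≤ ψ_σ*(k y) / k + c` with `k` a multiple of `n`. -/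
theorem exists_psiStar_le (h : σ.toFun =O[atTop] ω.toFun) (n : ℕ+) :
    ∃ (k : ℕ+) (c : ℝ), ∀ y : ℝ,
      1 / (n : ℝ) * ω.psiStar (n * y) ≤ 1 / (k : ℝ) * σ.psiStar (k * y) + c := by
  obtain ⟨C, hC⟩ := h.bound
  obtain ⟨T, hT⟩ := eventually_atTop.1 hC
  obtain ⟨M, hM⟩ := exists_nat_gt |C|
  have hM0 : 0 < M := by
    have : (0 : ℝ) < M := (abs_nonneg C).trans_lt hM
    exact_mod_cast this
  lift M to ℕ+ using hM0
  have hM' : (0 : ℝ) < M := by exact_mod_cast M.pos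
  have hn : (0 : ℝ) < n := by exact_mod_cast n.pos
  have key : ∀ x : ℝ, σ.psi x ≤ M * ω.psi x + σ |T| := by
    intro x
    have hw := ω.psi_nonneg x
    have hs := σ.nonneg (abs_nonneg T)
    rcases le_total T (Real.exp x) with hx | hx
    · have h1 := hT _ hx
      rw [Real.norm_of_nonneg (σ.nonneg (Real.exp_pos x).le),
        Real.norm_of_nonneg (ω.nonneg (Real.exp_pos x).le)] at h1
      have h2 : C * ω.psi x ≤ M * ω.psi x :=
        mul_le_mul_of_nonneg_right ((le_abs_self C).trans hM.le) hw
      have h3 : σ.psi x ≤ C * ω.psi x := h1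
      linarith
    · have h1 : σ.psi x ≤ σ |T| :=
        σ.monotone' (Real.exp_pos x).le (abs_nonneg T) (hx.trans (le_abs_self T))
      have : 0 ≤ M * ω.psi x := by positivity
      linarith
  refine ⟨n * M, 1 / (n : ℝ) * (σ |T| / M), fun y => ?_⟩
  have hk : (((n * M : ℕ+) : ℕ) : ℝ) = n * M := by
    rw [PNat.mul_coe, Nat.cast_mul]
  rw [hk]
  have hsup : ω.psiStar (n * y) ≤ 1 / M * σ.psiStar (n * M * y) + σ |T| / M := by
    apply ciSup_le
    rintro ⟨x, hx⟩
    have h1 := σ.le_psiStar (x := x) hx (n * M * y)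
    have h2 := key x
    rw [one_div, inv_mul_eq_div, ← add_div, le_div_iff₀ hM']
    simp only
    nlinarith
  calc 1 / (n : ℝ) * ω.psiStar (n * y)
      ≤ 1 / (n : ℝ) * (1 / M * σ.psiStar (n * M * y) + σ |T| / M) :=
        mul_le_mul_of_nonneg_left hsup (by positivity)
    _ = _ := by field_simp

/-- `n ↦ ψ*(n y) / n` is non-decreasing. -/
theorem psiStar_div_mono (ω : WeightFunction) {n m : ℕ+} (h : n ≤ m) (y : ℝ) :
    1 / (n : ℝ) * ω.psiStar (n * y) ≤ 1 / (m : ℝ) * ω.psiStar (m * y) := by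
  have hn : (0 : ℝ) < n := by exact_mod_cast n.pos
  have hm : (0 : ℝ) < m := by exact_mod_cast m.pos
  have hnm : (n : ℝ) ≤ m := by exact_mod_cast h
  have hsup : ω.psiStar (n * y) ≤ n / m * ω.psiStar (m * y) := by
    apply ciSup_le
    rintro ⟨x, hx⟩
    have h1 := ω.le_psiStar (x := x) hx (m * y)
    have h2 := ω.psi_nonneg x
    rw [div_mul_eq_mul_div, le_div_iff₀ hm]
    simp only
    nlinarith [mul_le_mul_of_nonneg_left h1 hn.le, mul_le_mul_of_nonneg_right hnm h2]
  calc 1 / (n : ℝ) * ω.psiStar (n * y) ≤ 1 / (n : ℝ) * (n / m * ω.psiStar (m * y)) :=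
        mul_le_mul_of_nonneg_left hsup (by positivity)
    _ = _ := by field_simp

end WeightFunction

/-- The partial derivative `φ^(α) = ∂₁^α₁ ⋯ ∂_d^α_d φ` of a smooth function: the `|α|`-th derivative
of `φ`, applied to `α₁` copies of the basis vector `e₁`, `α₂` copies of `e₂`, and so on. -/
def mderiv {d : ℕ} (α : Fin d → ℕ) (φ : EuclideanSpace ℝ (Fin d) → ℂ)
    (x : EuclideanSpace ℝ (Fin d)) : ℂ :=
  iteratedFDeriv ℝ (∑ i, α i) φ x fun j => EuclideanSpace.single (finSigmaFinEquiv.symm j).1 1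

section mderiv

variable {d : ℕ} {φ θ : EuclideanSpace ℝ (Fin d) → ℂ}

theorem mderiv_zero : mderiv 0 φ = φ := by
  have aux : ∀ k : ℕ, k = 0 → ∀ (x : EuclideanSpace ℝ (Fin d))
      (v : Fin k → EuclideanSpace ℝ (Fin d)), iteratedFDeriv ℝ k φ x v = φ x := by
    rintro k rfl x v
    rfl
  funext x
  exact aux _ (by simp) x _

theorem mderiv_add (hφ : ContDiff ℝ (⊤ : ℕ∞) φ) (hθ : ContDiff ℝ (⊤ : ℕ∞) θ) (α : Fin d → ℕ) :
    mderiv α (φ + θ) = mderiv α φ + mderiv α θ := by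
  funext x
  simp only [mderiv, Pi.add_apply]
  rw [iteratedFDeriv_add_apply (hφ.of_le (by exact_mod_cast le_top)).contDiffAt
    (hθ.of_le (by exact_mod_cast le_top)).contDiffAt]
  rfl

theorem mderiv_smul (hφ : ContDiff ℝ (⊤ : ℕ∞) φ) (c : ℂ) (α : Fin d → ℕ) :
    mderiv α (c • φ) = c • mderiv α φ := by
  funext x
  simp only [mderiv, Pi.smul_apply]
  rw [iteratedFDeriv_const_smul_apply (hφ.of_le (by exact_mod_cast le_top)).contDiffAt]
  rfl

end mderiv

/-- `‖φ^(α)‖_{L¹} exp(-ψ*(n|α|)/n)`. -/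
def weightedL1 (ω : WeightFunction) {d : ℕ} (n : ℕ+) (α : Fin d → ℕ)
    (φ : EuclideanSpace ℝ (Fin d) → ℂ) : ℝ :=
  (∫ x, ‖mderiv α φ x‖) * Real.exp (-(1 / (n : ℝ) * ω.psiStar (n * (∑ i, α i : ℕ))))

section weightedL1

variable (ω : WeightFunction) {d : ℕ} (n : ℕ+) (α : Fin d → ℕ)
  {φ θ : EuclideanSpace ℝ (Fin d) → ℂ}

theorem weightedL1_nonneg (φ : EuclideanSpace ℝ (Fin d) → ℂ) : 0 ≤ weightedL1 ω n α φ :=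
  mul_nonneg (integral_nonneg fun _ => norm_nonneg _) (Real.exp_pos _).le

theorem weightedL1_zero : weightedL1 ω n α (0 : EuclideanSpace ℝ (Fin d) → ℂ) = 0 := by
  have h := mderiv_smul (φ := (0 : EuclideanSpace ℝ (Fin d) → ℂ)) contDiff_const 0 α
  rw [smul_zero, zero_smul] at h
  simp [weightedL1, h]

theorem weightedL1_smul (hφ : ContDiff ℝ (⊤ : ℕ∞) φ) (c : ℂ) :
    weightedL1 ω n α (c • φ) = ‖c‖ * weightedL1 ω n α φ := by
  simp only [weightedL1, mderiv_smul hφ, Pi.smul_apply, norm_smul, integral_const_mul]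
  ring

theorem weightedL1_add_le (hφ : ContDiff ℝ (⊤ : ℕ∞) φ) (hθ : ContDiff ℝ (⊤ : ℕ∞) θ)
    (hφi : Integrable (mderiv α φ)) (hθi : Integrable (mderiv α θ)) :
    weightedL1 ω n α (φ + θ) ≤ weightedL1 ω n α φ + weightedL1 ω n α θ := by
  simp only [weightedL1, mderiv_add hφ hθ, ← add_mul]
  refine mul_le_mul_of_nonneg_right ?_ (Real.exp_pos _).le
  rw [← integral_add hφi.norm hθi.norm]
  exact integral_mono (hφi.add hθi).norm (hφi.norm.add hθi.norm) fun x => norm_add_le _ _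

end weightedL1

/-- The vector space underlying `𝓓_{L¹,ω,n}(ℝᵈ)`: the smooth functions `φ : ℝᵈ → ℂ` all of whose
partial derivatives are integrable and for which `sup_α ‖φ^(α)‖_{L¹} exp(-ψ*(n|α|)/n) < ∞`. -/
def DL1StepSubmodule (ω : WeightFunction) (d : ℕ) (n : ℕ+) :
    Submodule ℂ (EuclideanSpace ℝ (Fin d) → ℂ) where
  carrier := {φ | ContDiff ℝ (⊤ : ℕ∞) φ ∧ (∀ α : Fin d → ℕ, Integrable (mderiv α φ)) ∧
    BddAbove (Set.range fun α : Fin d → ℕ => weightedL1 ω n α φ)}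
  zero_mem' := by
    refine ⟨contDiff_const, fun α => ?_, 0, ?_⟩
    · have h := mderiv_smul (φ := (0 : EuclideanSpace ℝ (Fin d) → ℂ)) contDiff_const 0 α
      rw [smul_zero, zero_smul] at h
      rw [h]
      exact integrable_zero _ _ _
    · rintro _ ⟨α, rfl⟩
      exact (weightedL1_zero ω n α).le
  add_mem' := by
    rintro φ θ ⟨h1, h2, A, hA⟩ ⟨k1, k2, B, hB⟩
    refine ⟨h1.add k1, fun α => ?_, A + B, ?_⟩
    · rw [mderiv_add h1 k1]
      exact (h2 α).add (k2 α)
    · rintro _ ⟨α, rfl⟩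
      exact (weightedL1_add_le ω n α h1 k1 (h2 α) (k2 α)).trans
        (add_le_add (hA ⟨α, rfl⟩) (hB ⟨α, rfl⟩))
  smul_mem' := by
    rintro c φ ⟨h1, h2, A, hA⟩
    refine ⟨h1.const_smul c, fun α => ?_, ‖c‖ * A, ?_⟩
    · rw [mderiv_smul h1]
      exact (h2 α).smul c
    · rintro _ ⟨α, rfl⟩
      simp only [weightedL1_smul ω n α h1]
      exact mul_le_mul_of_nonneg_left (hA ⟨α, rfl⟩) (norm_nonneg c)

/-- If `σ = O(ω)`, every `𝓓_{L¹,ω,n}(ℝᵈ)` is contained in some `𝓓_{L¹,σ,k}(ℝᵈ)`. -/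
theorem DL1StepSubmodule.exists_le {ω σ : WeightFunction} (h : σ.toFun =O[atTop] ω.toFun) (d : ℕ)
    (n : ℕ+) : ∃ k : ℕ+, DL1StepSubmodule ω d n ≤ DL1StepSubmodule σ d k := by
  obtain ⟨k, c, hk⟩ := WeightFunction.exists_psiStar_le h n
  refine ⟨k, ?_⟩
  rintro φ ⟨h1, h2, A, hA⟩
  refine ⟨h1, h2, A * Real.exp c, ?_⟩
  rintro _ ⟨α, rfl⟩
  have hα : weightedL1 ω n α φ ≤ A := hA ⟨α, rfl⟩
  refine le_trans ?_ (mul_le_mul_of_nonneg_right hα (Real.exp_pos c).le)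
  simp only [weightedL1]
  rw [mul_assoc, ← Real.exp_add]
  refine mul_le_mul_of_nonneg_left (Real.exp_le_exp.2 ?_) (integral_nonneg fun _ => norm_nonneg _)
  have := hk (∑ i, α i : ℕ)
  linarith

theorem DL1StepSubmodule.mono (ω : WeightFunction) (d : ℕ) : Monotone (DL1StepSubmodule ω d) := by
  rintro n m h φ ⟨h1, h2, A, hA⟩
  refine ⟨h1, h2, A, ?_⟩
  rintro _ ⟨α, rfl⟩
  refine le_trans ?_ (hA ⟨α, rfl⟩)
  refine mul_le_mul_of_nonneg_left (Real.exp_le_exp.2 ?_) (integral_nonneg fun _ => norm_nonneg _)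
  exact neg_le_neg (ω.psiStar_div_mono h _)

/-- The normed space `𝓓_{L¹,ω,n}(ℝᵈ)`. -/
def DL1Step (ω : WeightFunction) (d : ℕ) (n : ℕ+) : Type := DL1StepSubmodule ω d n

namespace DL1Step

variable (ω : WeightFunction) (d : ℕ) (n : ℕ+)

instance : AddCommGroup (DL1Step ω d n) := inferInstanceAs (AddCommGroup (DL1StepSubmodule ω d n))

instance : Module ℂ (DL1Step ω d n) := inferInstanceAs (Module ℂ (DL1StepSubmodule ω d n))

/-- `‖φ‖ = sup_α ‖φ^(α)‖_{L¹} exp(-ψ*(n|α|)/n)`. -/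
instance : Norm (DL1Step ω d n) := ⟨fun φ => ⨆ α : Fin d → ℕ, weightedL1 ω n α φ.1⟩

theorem core : NormedSpace.Core ℂ (DL1Step ω d n) where
  norm_nonneg φ := Real.iSup_nonneg fun α => weightedL1_nonneg ω n α φ.1
  norm_smul c φ := by
    change (⨆ α : Fin d → ℕ, weightedL1 ω n α (c • φ.1)) = ‖c‖ * ⨆ α, weightedL1 ω n α φ.1
    simp only [weightedL1_smul ω n _ φ.2.1]
    rw [Real.mul_iSup_of_nonneg (norm_nonneg c)]
  norm_triangle φ θ := by
    change (⨆ α : Fin d → ℕ, weightedL1 ω n α (φ.1 + θ.1)) ≤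
      (⨆ α, weightedL1 ω n α φ.1) + ⨆ α, weightedL1 ω n α θ.1
    exact ciSup_le fun α => (weightedL1_add_le ω n α φ.2.1 θ.2.1 (φ.2.2.1 α) (θ.2.2.1 α)).trans
      (add_le_add (le_ciSup φ.2.2.2 α) (le_ciSup θ.2.2.2 α))
  norm_eq_zero_iff φ := by
    constructor
    · intro h
      have h0 : weightedL1 ω n 0 φ.1 = 0 :=
        le_antisymm ((le_ciSup φ.2.2.2 0).trans_eq h) (weightedL1_nonneg ω n 0 φ.1)
      have hi := φ.2.2.1 0
      simp only [weightedL1, mderiv_zero, mul_eq_zero, (Real.exp_pos _).ne', or_false] at h0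
      rw [mderiv_zero] at hi
      rw [integral_eq_zero_iff_of_nonneg (fun _ => norm_nonneg _) hi.norm] at h0
      have h1 : φ.1 =ᵐ[volume] fun _ => (0 : ℂ) := h0.mono fun x hx => norm_eq_zero.1 hx
      exact Subtype.ext ((Continuous.ae_eq_iff_eq volume φ.2.1.continuous continuous_const).1 h1)
    · rintro rfl
      change (⨆ α : Fin d → ℕ, weightedL1 ω n α 0) = 0
      simp only [weightedL1_zero]
      exact ciSup_const

instance : NormedAddCommGroup (DL1Step ω d n) := NormedAddCommGroup.ofCore (core ω d n)

instance : NormedSpace ℂ (DL1Step ω d n) := NormedSpace.ofCore (core ω d n)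

end DL1Step

/-- The vector space underlying `𝓓_{L¹,{ω}}(ℝᵈ)`: the union of the spaces `𝓓_{L¹,ω,n}(ℝᵈ)`. -/
def DL1Submodule (ω : WeightFunction) (d : ℕ) : Submodule ℂ (EuclideanSpace ℝ (Fin d) → ℂ) where
  carrier := {φ | ∃ n : ℕ+, φ ∈ DL1StepSubmodule ω d n}
  zero_mem' := ⟨1, Submodule.zero_mem _⟩
  add_mem' := by
    rintro φ θ ⟨n, hn⟩ ⟨m, hm⟩
    exact ⟨max n m, Submodule.add_mem _ (DL1StepSubmodule.mono ω d (le_max_left n m) hn)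
      (DL1StepSubmodule.mono ω d (le_max_right n m) hm)⟩
  smul_mem' := by
    rintro c φ ⟨n, hn⟩
    exact ⟨n, Submodule.smul_mem _ c hn⟩

/-- The space `𝓓_{L¹,{ω}}(ℝᵈ)`. -/
def DL1 (ω : WeightFunction) (d : ℕ) : Type := DL1Submodule ω d

namespace DL1

instance (ω : WeightFunction) (d : ℕ) : AddCommGroup (DL1 ω d) :=
  inferInstanceAs (AddCommGroup (DL1Submodule ω d))

instance (ω : WeightFunction) (d : ℕ) : Module ℂ (DL1 ω d) :=
  inferInstanceAs (Module ℂ (DL1Submodule ω d))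

/-- The inclusion `𝓓_{L¹,ω,n}(ℝᵈ) → 𝓓_{L¹,{ω}}(ℝᵈ)`. -/
def ofStep (ω : WeightFunction) (d : ℕ) (n : ℕ+) : DL1Step ω d n →ₗ[ℂ] DL1 ω d :=
  Submodule.inclusion (p := DL1StepSubmodule ω d n) (p' := DL1Submodule ω d) fun _ h => ⟨n, h⟩

/-- The topology of the locally convex inductive limit of the spaces `𝓓_{L¹,ω,n}(ℝᵈ)`: the finest
locally convex vector space topology for which all inclusions `ofStep` are continuous. -/
instance (ω : WeightFunction) (d : ℕ) : TopologicalSpace (DL1 ω d) :=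
  sInf {t : TopologicalSpace (DL1 ω d) | @IsTopologicalAddGroup (DL1 ω d) t _ ∧
    @ContinuousSMul ℂ (DL1 ω d) _ _ t ∧ @LocallyConvexSpace ℝ (DL1 ω d) _ _ _ _ t ∧
    ∀ n : ℕ+, @Continuous (DL1Step ω d n) (DL1 ω d) _ t (ofStep ω d n)}

/-- The inclusion `𝓓_{L¹,{ω}}(ℝᵈ) → 𝓓_{L¹,{σ}}(ℝᵈ)` if `σ = O(ω)`. -/
def inclusion {ω σ : WeightFunction} (h : σ.toFun =O[atTop] ω.toFun) (d : ℕ) :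
    DL1 ω d →ₗ[ℂ] DL1 σ d :=
  Submodule.inclusion (p := DL1Submodule ω d) (p' := DL1Submodule σ d) fun _ ⟨n, hn⟩ =>
    (DL1StepSubmodule.exists_le h d n).imp fun _ hk => hk hn

end DL1

/-- The space `𝓑'_{{ω}}(ℝᵈ)` of bounded infrahyperfunctions or bounded ultradistributions of class
`{ω}` of Roumieu type: the continuous linear functionals on `𝓓_{L¹,{ω}}(ℝᵈ)`. -/
abbrev BoundedInfrahyperfunction (ω : WeightFunction) (d : ℕ) : Type := DL1 ω d →L[ℂ] ℂ

end

/-! The proof decomposes functions in frequency. Integer translates of a smooth, compactly supported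
bump form a partition of unity, and with it every `φ` is the sum over lattice points `κ` of wave
packets `wavePacket (cubeWindow d) κ φ`, convolutions of `φ` with modulated copies of a band-limited
window (`hasSum_wavePacket`). Two effects compete. Smoothness of `φ` in step `m` for a weight `σ`
makes the packet at frequency `k` small, of order `exp(-σ(r)/m)` up to a factor `max 1 r`, where `r`
is a fixed multiple of `‖k‖`. Band limitation makes its derivatives grow only geometrically, so it
belongs to every step of every weight `ω`, at the price of a factor `exp(ω(R)/n)` with `R` affine in
`‖k‖` (`exists_norm_packetStep_le`). Both estimates express Young duality between `ψ` and `ψ*`.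

With `σ = ω` and `n` large compared with `m`, condition (α) lets the decay win, so the packet series
of `φ` converges in a step of `𝓓_{L¹,{ω}}` (`exists_hasSum_packetStep`). Hence `f φ` is the sum of
the values of `f` on the packets of `φ`.

These values still make sense for `φ` in a larger space. If `f` has norm at most `C_n` on step `n`,
its growth on packets is governed by `exp(h(r))`, where `h` is the infimum over `n` of `log(1 + C_n)
+ (K ω + K)/n`. An infimum over all `n` makes `h = o(ω)`. `WeightFunction.exists_isLittleO` inserts
a weight `σ` with `h = o(σ)` and `σ = o(ω)`; then `exp(h(r) - σ(r)/m)` is summable over the lattice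
for every `m` (`exists_norm_apply_packetStep_le`). The extension `g` is the sum of `f` over the
packets.

The convexity required of `σ` is the delicate point in choosing it: `exists_convexOn_isLittleO`
damps the slopes of `ψ` by a slowly decreasing null sequence and restores their monotonicity by
taking running maxima. -/

noncomputable section

/-! ### Young duality and growth of weight functions -/

namespace WeightFunction

variable (ω : WeightFunction)

theorem psi_monotoneOn : MonotoneOn ω.psi (Set.Ici 0) := fun _ _ _ _ h =>
  ω.monotone' (Real.exp_pos _).le (Real.exp_pos _).le (Real.exp_le_exp.2 h)

theorem psi_zero : ω.psi 0 = 0 := by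
  simpa [psi] using ω.zero' 1 ⟨zero_le_one, le_rfl⟩

theorem psiStar_mono {y z : ℝ} (h : y ≤ z) : ω.psiStar y ≤ ω.psiStar z := by
  apply ciSup_le
  rintro ⟨x, hx⟩
  have h1 := ω.le_psiStar (x := x) hx z
  have h2 : x * y ≤ x * z := mul_le_mul_of_nonneg_left h hx
  simp only
  linarith

theorem psiStar_zero_le : ω.psiStar 0 ≤ 0 := by
  apply ciSup_le
  rintro ⟨x, hx⟩
  simpa using ω.psi_nonneg x

/-- The right derivative of the convex function `ψ` at `x` is a subgradient, and a subgradient gives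
equality in Young's inequality. It is non-negative because `ψ 0 = 0 ≤ ψ x`. -/
theorem exists_psi_add_psiStar_le {x : ℝ} (hx : 0 ≤ x) :
    ∃ y, 0 ≤ y ∧ ω.psi x + ω.psiStar y ≤ x * y := by
  rcases hx.eq_or_lt with rfl | hx
  · refine ⟨0, le_rfl, ?_⟩
    have := ω.psiStar_zero_le
    rw [psi_zero]
    linarith
  have hi : x ∈ interior (Set.Ici (0 : ℝ)) := by simpa using hx
  have hc : ConvexOn ℝ (Set.Ici 0) ω.psi := ω.delta
  have hlr := hc.leftDeriv_le_rightDeriv_of_mem_interior hi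
  have hl : ∀ u, 0 ≤ u → u < x →
      (ω.psi x - ω.psi u) ≤ derivWithin ω.psi (Set.Ioi x) x * (x - u) := by
    intro u hu hux
    have := hc.slope_le_leftDeriv_of_mem_interior hu hi hux
    rw [slope_def_field, div_le_iff₀ (by linarith)] at this
    exact this.trans (mul_le_mul_of_nonneg_right hlr (by linarith))
  have hr : ∀ u, x < u → derivWithin ω.psi (Set.Ioi x) x * (u - x) ≤ ω.psi u - ω.psi x := by
    intro u hux
    have := hc.rightDeriv_le_slope_of_mem_interior hi (Set.mem_Ici.2 (hx.trans hux).le) hux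
    rwa [slope_def_field, le_div_iff₀ (by linarith)] at this
  refine ⟨derivWithin ω.psi (Set.Ioi x) x, ?_, ?_⟩
  · have h0 := hl 0 le_rfl hx
    rw [psi_zero, sub_zero, sub_zero] at h0
    exact nonneg_of_mul_nonneg_left ((ω.psi_nonneg x).trans h0) hx
  · suffices h : ω.psiStar (derivWithin ω.psi (Set.Ioi x) x) ≤
        x * derivWithin ω.psi (Set.Ioi x) x - ω.psi x by linarith
    apply ciSup_le
    rintro ⟨u, hu⟩
    simp only
    rcases lt_trichotomy u x with h | h | h
    · linarith [hl u hu h]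
    · rw [h]
    · linarith [hr u h]

/-- If `X rᵐ ≤ A exp(ψ*(n m)/n)` for all `m`, then `X` decays like `exp(-ω(r)/n)`. -/
theorem le_exp_of_forall_pow (n : ℕ+) {r X A : ℝ} (hr : 0 ≤ r) (hA : 0 ≤ A)
    (h : ∀ m : ℕ, X * r ^ m ≤ A * Real.exp (1 / (n : ℝ) * ω.psiStar (n * m))) :
    X ≤ A * max 1 r * Real.exp (-(1 / (n : ℝ) * ω r)) := by
  have hn : (0 : ℝ) < n := by exact_mod_cast n.pos
  rcases le_or_gt r 1 with h1 | h1
  · rw [max_eq_left h1, ω.zero' r ⟨hr, h1⟩]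
    have h0 := h 0
    simp only [pow_zero, mul_one, Nat.cast_zero, mul_zero] at h0
    have h2 : 1 / (n : ℝ) * ω.psiStar 0 ≤ 0 :=
      mul_nonpos_of_nonneg_of_nonpos (by positivity) ω.psiStar_zero_le
    simpa using h0.trans (mul_le_mul_of_nonneg_left (Real.exp_le_one_iff.2 h2) hA)
  · rw [max_eq_right h1.le]
    have hr0 : 0 < r := zero_lt_one.trans h1
    obtain ⟨y, hy, hxy⟩ := ω.exists_psi_add_psiStar_le (Real.log_nonneg h1.le)
    have hpsi : ω.psi (Real.log r) = ω r := by rw [psi, Real.exp_log hr0]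
    rw [hpsi] at hxy
    -- The optimal real exponent is `y / n`. Rounding down keeps `ψ*(n m) ≤ ψ*(y)` and costs at most
    -- one factor `r`, the source of `max 1 r` in the conclusion.
    set m := ⌊y / n⌋₊
    have hm1 : (n : ℝ) * m ≤ y := by
      have := Nat.floor_le (div_nonneg hy hn.le)
      rw [le_div_iff₀ hn] at this
      linarith
    have hm2 : y ≤ n * (m + 1) := by
      have := (Nat.lt_floor_add_one (y / n)).le
      rw [div_le_iff₀ hn] at this
      linarith
    have hm := h m
    have hlog := Real.log_nonneg h1.le
    have hkey : 1 / (n : ℝ) * ω.psiStar (n * m) ≤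
        m * Real.log r + Real.log r - 1 / (n : ℝ) * ω r := by
      have h2 := ω.psiStar_mono hm1
      have h3 : Real.log r * y ≤ Real.log r * (n * (m + 1)) := mul_le_mul_of_nonneg_left hm2 hlog
      have h4 : 1 / (n : ℝ) * ω.psiStar (n * m) ≤
          1 / (n : ℝ) * (Real.log r * (n * (m + 1)) - ω r) :=
        mul_le_mul_of_nonneg_left (by linarith) (by positivity)
      refine h4.trans_eq ?_
      field_simp
    have hpow : r ^ m = Real.exp (m * Real.log r) := by
      rw [Real.exp_nat_mul, Real.exp_log hr0]
    have h5 : X * r ^ m ≤ (A * r * Real.exp (-(1 / (n : ℝ) * ω r))) * r ^ m := by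
      refine hm.trans ?_
      calc A * Real.exp (1 / (n : ℝ) * ω.psiStar (n * m))
          ≤ A * Real.exp (m * Real.log r + Real.log r - 1 / (n : ℝ) * ω r) := by gcongr
        _ = A * r * Real.exp (-(1 / (n : ℝ) * ω r)) * r ^ m := by
            rw [hpow, sub_eq_add_neg, Real.exp_add, Real.exp_add, Real.exp_log hr0]
            ring
    exact le_of_mul_le_mul_right h5 (by positivity)

/-- Young's inequality at the point `log R`. It turns geometric growth of derivatives into
membership in every step. -/
theorem pow_mul_exp_psiStar_le (n : ℕ+) {R : ℝ} (hR : 1 ≤ R) (l : ℕ) :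
    R ^ l * Real.exp (-(1 / (n : ℝ) * ω.psiStar (n * l))) ≤ Real.exp (1 / (n : ℝ) * ω R) := by
  have hn : (0 : ℝ) < n := by exact_mod_cast n.pos
  have hR0 : 0 < R := zero_lt_one.trans_le hR
  have hpow : R ^ l = Real.exp (l * Real.log R) := by rw [Real.exp_nat_mul, Real.exp_log hR0]
  have h1 := ω.le_psiStar (Real.log_nonneg hR) (n * l)
  rw [psi, Real.exp_log hR0] at h1
  rw [hpow, ← Real.exp_add, Real.exp_le_exp]
  have h2 : 1 / (n : ℝ) * (Real.log R * (n * l) - ω R) ≤ 1 / (n : ℝ) * ω.psiStar (n * l) :=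
    mul_le_mul_of_nonneg_left h1 (by positivity)
  have h3 : 1 / (n : ℝ) * (Real.log R * (n * l) - ω R) = l * Real.log R - 1 / (n : ℝ) * ω R := by
    field_simp
  linarith

theorem tendsto_atTop : Tendsto ω.toFun atTop atTop := by
  have h := (isLittleO_iff.1 ω.gamma) zero_lt_one
  refine tendsto_atTop_mono' _ ?_ Real.tendsto_log_atTop
  filter_upwards [h, eventually_ge_atTop 0] with t ht h0
  rw [one_mul, Real.norm_of_nonneg (ω.nonneg h0)] at ht
  exact (le_abs_self _).trans ht

theorem exists_two_mul_le : ∃ K : ℝ, 1 ≤ K ∧ ∀ t, 0 ≤ t → ω (2 * t) ≤ K * ω t + K := by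
  obtain ⟨C, hC⟩ := ω.alpha.bound
  obtain ⟨T, hT⟩ := eventually_atTop.1 hC
  refine ⟨max 1 |C| + ω (2 * |T|), ?_, fun t ht => ?_⟩
  · linarith [le_max_left 1 |C|, ω.nonneg (by positivity : 0 ≤ 2 * |T|)]
  have hw := ω.nonneg ht
  have hT0 := ω.nonneg (by positivity : 0 ≤ 2 * |T|)
  have hm := le_max_right 1 |C|
  have hm1 := le_max_left 1 |C|
  rcases le_total T t with h | h
  · have h1 := hT t h
    rw [Real.norm_of_nonneg hw, Real.norm_of_nonneg (ω.nonneg (by positivity))] at h1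
    have h2 : C * ω t ≤ max 1 |C| * ω t :=
      mul_le_mul_of_nonneg_right ((le_abs_self C).trans hm) hw
    nlinarith
  · have h1 : ω (2 * t) ≤ ω (2 * |T|) :=
      ω.monotone' (by simpa using ht) (by simp) (by linarith [le_abs_self T])
    nlinarith

theorem exists_pow_two_mul_le (k : ℕ) :
    ∃ K : ℝ, 1 ≤ K ∧ ∀ t, 0 ≤ t → ω (2 ^ k * t) ≤ K * ω t + K := by
  induction k with
  | zero => exact ⟨1, le_rfl, fun t _ => by simp⟩
  | succ k ih =>
    obtain ⟨K, hK, h⟩ := ih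
    obtain ⟨K', hK', h'⟩ := ω.exists_two_mul_le
    refine ⟨K' * K + K', by nlinarith, fun t ht => ?_⟩
    have h1 := h' (2 ^ k * t) (by positivity)
    have h2 := h t ht
    have h3 := ω.nonneg ht
    rw [pow_succ', mul_assoc]
    nlinarith [mul_le_mul_of_nonneg_left h2 (zero_le_one.trans hK')]

/-- With `L + B < 2 ^ k`, the argument is at most `2 ^ k * max t 1`, so iterated doubling applies.
For `t ≤ 1` the bound is the additive `K`, since `ω 1 = 0`. -/
theorem exists_affine_le {L B : ℝ} (hL : 0 ≤ L) (hB : 0 ≤ B) :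
    ∃ K : ℝ, 1 ≤ K ∧ ∀ t, 0 ≤ t → ω (L * t + B) ≤ K * ω t + K := by
  obtain ⟨k, hk⟩ := pow_unbounded_of_one_lt (L + B) (one_lt_two (α := ℝ))
  obtain ⟨K, hK, h⟩ := ω.exists_pow_two_mul_le k
  refine ⟨K, hK, fun t ht => ?_⟩
  have hw := ω.nonneg ht
  have hmono : ∀ s, t ≤ s → 1 ≤ s → ω (L * t + B) ≤ ω (2 ^ k * s) := fun s hts hs =>
    ω.monotone' (Set.mem_Ici.2 (by positivity)) (Set.mem_Ici.2 (by positivity)) (by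
      nlinarith [mul_le_mul_of_nonneg_left hts hL, mul_le_mul_of_nonneg_left hs hB])
  rcases le_total 1 t with h1 | h1
  · exact (hmono t le_rfl h1).trans (h t ht)
  · have h2 := (hmono 1 h1 le_rfl).trans (h 1 zero_le_one)
    rw [ω.zero' 1 ⟨zero_le_one, le_rfl⟩] at h2
    nlinarith

theorem exists_exp_neg_le (n : ℕ+) (N : ℕ) :
    ∃ C : ℝ, ∀ t, 0 ≤ t → Real.exp (-(1 / (n : ℝ) * ω t)) ≤ C * ((1 + t) ^ N)⁻¹ := by
  have hn : (0 : ℝ) < n := by exact_mod_cast n.pos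
  -- This constant gives `N log t ≤ ω(t)/n` for large `t`; `N + 1` in place of `N` covers `N = 0`.
  have h := (isLittleO_iff.1 ω.gamma) (c := 1 / (n * (N + 1))) (by positivity)
  obtain ⟨T, hT⟩ := eventually_atTop.1 h
  set S := max T 1
  refine ⟨(1 + S) ^ N + 2 ^ N, fun t ht => ?_⟩
  rw [← div_eq_mul_inv, le_div_iff₀ (by positivity)]
  have hw := ω.nonneg ht
  rcases le_total S t with h1 | h1
  · have ht1 : 1 ≤ t := (le_max_right _ _).trans h1
    have h2 := hT t ((le_max_left _ _).trans h1)
    rw [Real.norm_of_nonneg hw, Real.norm_of_nonneg (Real.log_nonneg ht1), one_div,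
      inv_mul_eq_div, le_div_iff₀ (by positivity)] at h2
    have h3 : N * Real.log t ≤ 1 / (n : ℝ) * ω t := by
      rw [one_div, inv_mul_eq_div, le_div_iff₀ hn]
      nlinarith [mul_nonneg (Real.log_nonneg ht1) hn.le]
    have h4 : (1 + t) ^ N ≤ 2 ^ N * Real.exp (N * Real.log t) := by
      rw [Real.exp_nat_mul, Real.exp_log (by linarith), ← mul_pow]
      gcongr
      linarith
    calc Real.exp (-(1 / (n : ℝ) * ω t)) * (1 + t) ^ N
        ≤ Real.exp (-(1 / (n : ℝ) * ω t)) * (2 ^ N * Real.exp (1 / (n : ℝ) * ω t)) := by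
          gcongr
          exact h4.trans (by gcongr)
      _ = 2 ^ N := by
          rw [mul_left_comm, ← Real.exp_add]
          simp
      _ ≤ _ := by
          have : 0 ≤ (1 + S) ^ N := by positivity
          linarith
  · calc Real.exp (-(1 / (n : ℝ) * ω t)) * (1 + t) ^ N ≤ 1 * (1 + S) ^ N := by
          gcongr
          exact Real.exp_le_one_iff.2 (by simpa using by positivity)
      _ ≤ _ := by
          have : (0 : ℝ) ≤ 2 ^ N := by positivity
          linarith

end WeightFunction

/-! ### Construction of an intermediate weight -/

/-- A null sequence is `o(q)` for some antitone null sequence `q` with values in `(0, 1]`. -/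
theorem exists_antitone_isLittleO {e : ℕ → ℝ} (he : Tendsto e atTop (nhds 0)) :
    ∃ q : ℕ → ℝ, Antitone q ∧ (∀ j, 0 < q j ∧ q j ≤ 1) ∧ Tendsto q atTop (nhds 0) ∧ e =o[atTop] q := by
  obtain ⟨M, hM⟩ := (he.abs.bddAbove_range)
  have hb : ∀ j, BddAbove (Set.range fun i => |e (j + i)|) := fun j =>
    ⟨M, by rintro _ ⟨i, rfl⟩; exact hM ⟨j + i, rfl⟩⟩
  set E : ℕ → ℝ := fun j => ⨆ i, |e (j + i)|
  have hE0 : ∀ j, 0 ≤ E j := fun j => Real.iSup_nonneg fun i => abs_nonneg _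
  have heE : ∀ j, |e j| ≤ E j := fun j => le_ciSup (hb j) 0
  have hE : Antitone E := fun j k hjk => by
    refine ciSup_le fun i => ?_
    obtain ⟨l, rfl⟩ := Nat.exists_eq_add_of_le hjk
    rw [add_assoc]
    exact le_ciSup (hb j) (l + i)
  have hEt : Tendsto E atTop (nhds 0) := by
    rw [Metric.tendsto_atTop]
    intro ε hε
    obtain ⟨N, hN⟩ := Metric.tendsto_atTop.1 he (ε / 2) (by positivity)
    refine ⟨N, fun j hj => ?_⟩
    rw [Real.dist_eq, sub_zero, abs_of_nonneg (hE0 j)]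
    refine lt_of_le_of_lt (ciSup_le fun i => ?_) (half_lt_self hε)
    have := hN (j + i) (by omega)
    rw [Real.dist_eq, sub_zero] at this
    exact this.le
  have hs : Tendsto (fun j => √(E j)) atTop (nhds 0) := by
    simpa only [Real.sqrt_zero, Function.comp_def] using (Real.continuous_sqrt.tendsto 0).comp hEt
  have hsum : Tendsto (fun j : ℕ => √(E j) + 1 / ((j : ℝ) + 1)) atTop (nhds 0) := by
    simpa using hs.add tendsto_one_div_add_atTop_nhds_zero_nat
  -- The tail suprema `E` are antitone and dominate `|e|`; the square root gains the little-o, since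
  -- `E = √E * √E`. The term `1 / (j + 1)` keeps the sequence positive where `E` vanishes.
  refine ⟨fun j => min 1 (√(E j) + 1 / (j + 1)), ?_, ?_, ?_, ?_⟩
  · intro j k hjk
    refine min_le_min le_rfl (add_le_add (Real.sqrt_le_sqrt (hE hjk)) ?_)
    exact one_div_le_one_div_of_le (by positivity) (by exact_mod_cast Nat.succ_le_succ hjk)
  · exact fun j => ⟨lt_min one_pos (by positivity), min_le_left _ _⟩
  · simpa using tendsto_const_nhds (x := (1 : ℝ)).min hsum
  · rw [isLittleO_iff]
    intro c hc
    filter_upwards [hs.eventually (gt_mem_nhds hc), hsum.eventually (gt_mem_nhds one_pos)]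
      with j h1 h2
    have h0 : 0 ≤ √(E j) + 1 / ((j : ℝ) + 1) := by positivity
    rw [min_eq_right h2.le, Real.norm_of_nonneg h0, Real.norm_eq_abs]
    calc |e j| ≤ √(E j) * √(E j) := (heE j).trans_eq (Real.mul_self_sqrt (hE0 j)).symm
      _ ≤ c * (√(E j) + 1 / (j + 1)) := by
        gcongr
        have : (0 : ℝ) ≤ 1 / (j + 1) := by positivity
        linarith

end

noncomputable section

/-- Between a monotone function `H = o(ψ)` and a convex function `ψ` with `ψ(x+1) = O(ψ(x))` there
is a convex function of the same kind. -/
theorem exists_convexOn_isLittleO {ψ H : ℝ → ℝ} (hc : ConvexOn ℝ (Set.Ici 0) ψ)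
    (hm : MonotoneOn ψ (Set.Ici 0)) (h0 : ψ 0 = 0) {K : ℝ} (hK : 1 ≤ K)
    (hψK : ∀ x, 0 ≤ x → ψ (x + 1) ≤ K * ψ x + K) (hid : (fun x : ℝ => x) =o[atTop] ψ)
    (hHm : MonotoneOn H (Set.Ici 0)) (hH0 : ∀ x, 0 ≤ x → 0 ≤ H x) (hH : H =o[atTop] ψ) :
    ∃ Ψ : ℝ → ℝ, Continuous Ψ ∧ MonotoneOn Ψ (Set.Ici 0) ∧ ConvexOn ℝ (Set.Ici 0) Ψ ∧ Ψ 0 = 0 ∧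
      (∃ K' : ℝ, 1 ≤ K' ∧ ∀ x, 0 ≤ x → Ψ (x + 1) ≤ K' * Ψ x + K') ∧ H =o[atTop] Ψ ∧
      Ψ =o[atTop] ψ := by
  have hψ0 : ∀ x, 0 ≤ x → 0 ≤ ψ x := fun x hx => h0 ▸ hm Set.self_mem_Ici hx hx
  have hψt : Tendsto ψ atTop atTop := by
    refine tendsto_atTop_mono' _ ?_ tendsto_id
    filter_upwards [(isLittleO_iff.1 hid) zero_lt_one, eventually_ge_atTop 0] with x hx h0x
    rw [one_mul, Real.norm_of_nonneg h0x, Real.norm_of_nonneg (hψ0 x h0x)] at hx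
    exact hx
  set u : ℕ → ℝ := fun j => ψ j with hu
  have hu0 : ∀ j, 0 ≤ u j := fun j => hψ0 j j.cast_nonneg
  have hut : Tendsto u atTop atTop := hψt.comp tendsto_natCast_atTop_atTop
  set p : ℕ → ℝ := fun j => u (j + 1) - u j with hp
  have hup : ∀ j, u (j + 1) = u j + p j := fun j => by simp [hp]
  have hp0 : ∀ j, 0 ≤ p j := fun j => sub_nonneg.2 (hm (Set.mem_Ici.2 j.cast_nonneg)
    (Set.mem_Ici.2 (j + 1).cast_nonneg) (by simp))
  have hpm : Monotone p := monotone_nat_of_le_succ fun j => by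
    have := hc.slope_mono_adjacent (x := (j : ℝ)) (y := (j : ℝ) + 1) (z := (j : ℝ) + 1 + 1)
      (Set.mem_Ici.2 (by positivity)) (Set.mem_Ici.2 (by positivity)) (by linarith) (by linarith)
    simpa [hp, hu] using this
  have huj : ∀ j, u j ≤ j * p j := by
    intro j
    induction j with
    | zero => simp [hu, h0]
    | succ j ih =>
      rw [hup]
      push_cast
      nlinarith [hpm (Nat.le_succ j), (j.cast_nonneg : (0 : ℝ) ≤ j)]
  have hpt : Tendsto p atTop atTop := by
    rw [tendsto_atTop]
    intro M
    have h1 := (isLittleO_iff.1 hid) (c := 1 / (|M| + 1)) (by positivity)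
    filter_upwards [tendsto_natCast_atTop_atTop.eventually h1, eventually_gt_atTop 0] with j hj hj0
    have hj0' : (0 : ℝ) < j := by exact_mod_cast hj0
    rw [Real.norm_of_nonneg hj0'.le, Real.norm_of_nonneg (hu0 j), one_div, inv_mul_eq_div,
      le_div_iff₀ (by positivity)] at hj
    have h2 := hj.trans (huj j)
    have h3 := le_of_mul_le_mul_left h2 hj0'
    linarith [le_abs_self M]
  have hKu : ∀ j, u (j + 1) ≤ K * u j + K := fun j => by
    simpa [hu] using hψK j j.cast_nonneg
  -- The shift `H (j + 1) / u j` anticipates the passage to real `x` with `⌊x⌋ = j`, where `H x ≤ H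
  -- (j + 1)` while only `Ψ j ≤ Ψ x` is known. The growth condition on `ψ` makes the shift harmless.
  obtain ⟨q, hqa, hq, hqt, heq⟩ : ∃ q : ℕ → ℝ, Antitone q ∧ (∀ j, 0 < q j ∧ q j ≤ 1) ∧
      Tendsto q atTop (nhds 0) ∧ (fun j : ℕ => H (j + 1) / u j) =o[atTop] q := by
    refine exists_antitone_isLittleO ?_
    rw [Metric.tendsto_atTop']
    intro ε hε
    have h1 := (isLittleO_iff.1 hH) (c := ε / (4 * K)) (by positivity)
    have h2 := (tendsto_natCast_atTop_atTop (R := ℝ)).comp (tendsto_add_atTop_nat 1)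
    have h3 := ((h2.eventually h1).and (hut.eventually_ge_atTop 1)).and (eventually_ge_atTop 0)
    obtain ⟨N, hN⟩ := eventually_atTop.1 h3
    refine ⟨N, fun j hj => ?_⟩
    obtain ⟨⟨h4, h5⟩, -⟩ := hN j hj.le
    simp only [Function.comp_apply, Nat.cast_add, Nat.cast_one] at h4
    have hj1 : (0 : ℝ) ≤ j + 1 := by positivity
    have hju := hKu j
    simp only [hu, Nat.cast_add, Nat.cast_one] at hju h5 ⊢
    rw [Real.norm_of_nonneg (hH0 _ hj1), Real.norm_of_nonneg (hψ0 _ hj1)] at h4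
    rw [Real.dist_eq, sub_zero, abs_of_nonneg (div_nonneg (hH0 _ hj1) (by linarith)),
      div_lt_iff₀ (by linarith)]
    calc H (j + 1) ≤ ε / (4 * K) * ψ (j + 1) := h4
      _ ≤ ε / (4 * K) * (K * ψ j + K * ψ j) := by
        gcongr
        nlinarith
      _ = ε / 2 * ψ j := by field_simp; ring
      _ < ε * ψ j := by nlinarith
  -- The damped slopes `p j * q j` need not increase. Their running maximum does, so its
  -- step-function primitive `Ψ` is convex.
  set P : ℕ →o ℝ := partialSups fun j => p j * q j with hP
  have hpP : ∀ j, p j * q j ≤ P j := fun j => le_partialSups (fun j => p j * q j) j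
  have hP0 : ∀ j, 0 ≤ P j := fun j => (mul_nonneg (hp0 j) (hq j).1.le).trans (hpP j)
  set f : ℝ → ℝ := fun s => P ⌊s⌋₊ with hf
  have hfm : Monotone f := fun s t h => P.monotone (Nat.floor_mono h)
  have hfi : ∀ a b, IntervalIntegrable f volume a b := fun a b => hfm.intervalIntegrable
  set Ψ : ℝ → ℝ := fun x => ∫ s in (0 : ℝ)..x, f s with hΨ
  have hsub : ∀ a b, Ψ b - Ψ a = ∫ s in a..b, f s := fun a b =>
    intervalIntegral.integral_interval_sub_left (hfi _ _) (hfi _ _)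
  have hlow : ∀ a b, a ≤ b → f a * (b - a) ≤ Ψ b - Ψ a := fun a b hab => by
    rw [hsub]
    have := intervalIntegral.integral_mono_on hab (intervalIntegrable_const (c := f a)) (hfi a b)
      fun s hs => hfm hs.1
    simpa [mul_comm] using this
  have hupp : ∀ a b, a ≤ b → Ψ b - Ψ a ≤ f b * (b - a) := fun a b hab => by
    rw [hsub]
    have := intervalIntegral.integral_mono_on hab (hfi a b) (intervalIntegrable_const (c := f b))
      fun s hs => hfm hs.2
    simpa [mul_comm] using this
  have hΨm : Monotone Ψ := fun a b hab => by
    have h1 := hlow a b hab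
    have h2 : 0 ≤ f a * (b - a) := mul_nonneg (hP0 _) (by linarith)
    linarith
  have hΨ0 : Ψ 0 = 0 := by simp [hΨ]
  have hstep : ∀ j : ℕ, Ψ (j + 1) = Ψ j + P j := fun j => by
    have h1 : ∫ s in (j : ℝ)..(j + 1), f s = ∫ s in (j : ℝ)..(j + 1), P j := by
      refine intervalIntegral.integral_congr_Ioo_of_le (by linarith) fun s hs => ?_
      simp only [hf]
      rw [(Nat.floor_eq_iff (j.cast_nonneg.trans hs.1.le)).2 ⟨hs.1.le, hs.2⟩]
    have h2 := hsub j (j + 1)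
    rw [h1] at h2
    simp at h2
    linarith
  -- A discrete summation by parts: since `q` decreases, `q (j+1) * u (j+1) ≤ q j * u j + q j * p
  -- j`, and the last term is at most `P j`.
  have hqu : ∀ j : ℕ, q j * u j ≤ Ψ j := by
    intro j
    induction j with
    | zero => simp [hu, h0, hΨ0]
    | succ j ih =>
      have h1 := mul_le_mul_of_nonneg_right (hqa (Nat.le_succ j)) (hu0 (j + 1))
      have h2 := hpP j
      push_cast
      rw [hstep]
      rw [hup] at h1 ⊢
      linarith
  have hPΨ : ∀ j : ℕ, P j ≤ K * Ψ j + K := fun j => by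
    refine partialSups_le _ _ _ fun i hi => ?_
    have h1 : Ψ i ≤ Ψ j := hΨm (by exact_mod_cast hi)
    have h2 : p i ≤ K * u i + K := by linarith [hKu i, hup i, hu0 i]
    have h3 := mul_le_mul_of_nonneg_right h2 (hq i).1.le
    nlinarith [hqu i, (hq i).2]
  have hΨstep : ∀ j : ℕ, Ψ (j + 1) ≤ (K + 1) * Ψ j + K := fun j => by
    rw [hstep]
    linarith [hPΨ j]
  have hΨnn : ∀ x, 0 ≤ x → 0 ≤ Ψ x := fun x hx => hΨ0 ▸ hΨm hx
  refine ⟨Ψ, intervalIntegral.continuous_primitive hfi 0, hΨm.monotoneOn _, ?_, hΨ0, ?_, ?_, ?_⟩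
  · refine convexOn_of_slope_mono_adjacent (convex_Ici 0) fun {x y z} _ _ hxy hyz => ?_
    have h1 := hupp x y hxy.le
    have h2 := hlow y z hyz.le
    exact ((div_le_iff₀ (by linarith)).2 h1).trans ((le_div_iff₀ (by linarith)).2 h2)
  · refine ⟨(K + 1) ^ 2, by nlinarith, fun x hx => ?_⟩
    have h1 : Ψ ⌊x⌋₊ ≤ Ψ x := hΨm (Nat.floor_le hx)
    have h2 : Ψ (x + 1) ≤ Ψ ((⌊x⌋₊ + 1 : ℕ) + 1) :=
      hΨm (by push_cast; linarith [Nat.lt_floor_add_one x])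
    have h3 := hΨstep (⌊x⌋₊ + 1)
    have h4 := hΨstep ⌊x⌋₊
    push_cast at h2 h3
    nlinarith [hΨnn ⌊x⌋₊ (Nat.cast_nonneg _)]
  · rw [isLittleO_iff]
    intro c hc'
    have h1 := (isLittleO_iff.1 heq) hc'
    have h2 := tendsto_nat_floor_atTop (α := ℝ)
    filter_upwards [h2.eventually h1, h2.eventually (hut.eventually_gt_atTop 0),
      eventually_ge_atTop 0] with x h3 h4 hx
    set j := ⌊x⌋₊
    have hj1 : (0 : ℝ) ≤ j + 1 := by positivity
    rw [Real.norm_of_nonneg (div_nonneg (hH0 _ hj1) h4.le), Real.norm_of_nonneg (hq j).1.le,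
      div_le_iff₀ h4] at h3
    rw [Real.norm_of_nonneg (hH0 x hx), Real.norm_of_nonneg (hΨnn x hx)]
    calc H x ≤ H (j + 1) := hHm hx hj1 (Nat.lt_floor_add_one x).le
      _ ≤ c * q j * u j := h3
      _ ≤ c * Ψ x := by
        rw [mul_assoc]
        gcongr
        exact (hqu j).trans (hΨm (Nat.floor_le hx))
  · rw [isLittleO_iff]
    intro c hc'
    -- The factor `K` pays for replacing `ψ x` by `u (⌊x⌋ + 1)`; the other half of `c` absorbs the
    -- constants once `ψ x` is large.
    set ε := c / (2 * K) with hε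
    have hε0 : 0 < ε := by positivity
    obtain ⟨N, hN⟩ := (hqt.eventually (gt_mem_nhds hε0)).exists
    obtain ⟨N', hN'⟩ := eventually_atTop.1 (hpt.eventually_ge_atTop (P N / ε))
    have hPp : ∀ j, N' ≤ j → P j ≤ ε * p j := fun j hj => by
      have h1 := hN' j hj
      rw [div_le_iff₀ hε0] at h1
      refine partialSups_le _ _ _ fun i hi => ?_
      -- The finitely many slopes up to `N` are dominated because `p j` tends to infinity; beyond
      -- `N` the factor `q i` is at most `ε` and `p` is monotone.
      rcases le_total i N with hiN | hiN
      · exact ((hpP i).trans (P.monotone hiN)).trans (by linarith)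
      · have h2 := hqa hiN
        rw [mul_comm]
        exact mul_le_mul (h2.trans hN.le) (hpm hi) (hp0 i) hε0.le
    have hΨu : ∀ k, Ψ (N' + k : ℕ) ≤ Ψ N' + ε * u (N' + k) := by
      intro k
      induction k with
      | zero => simpa using mul_nonneg hε0.le (hu0 N')
      | succ k ih =>
        rw [← add_assoc, hup, Nat.cast_succ, hstep]
        linarith [hPp (N' + k) (Nat.le_add_right _ _)]
    have h2 := tendsto_nat_floor_atTop (α := ℝ)
    filter_upwards [h2.eventually_ge_atTop N', hψt.eventually_ge_atTop ((Ψ N' + ε * K) / (c / 2)),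
      eventually_ge_atTop 0] with x h3 h4 hx
    rw [div_le_iff₀ (by positivity)] at h4
    rw [Real.norm_of_nonneg (hψ0 x hx), Real.norm_of_nonneg (hΨnn x hx)]
    obtain ⟨k, hk⟩ := Nat.exists_eq_add_of_le h3
    have h5 : Ψ x ≤ Ψ (N' + (k + 1) : ℕ) :=
      hΨm (by rw [← add_assoc, ← hk]; push_cast; exact (Nat.lt_floor_add_one x).le)
    have h6 : u (N' + (k + 1)) ≤ K * ψ x + K := by
      refine le_trans ?_ (hψK x hx)
      refine hm (Set.mem_Ici.2 (by positivity)) (Set.mem_Ici.2 (by positivity)) ?_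
      rw [← add_assoc, ← hk]
      push_cast
      linarith [Nat.floor_le hx]
    have h7 : ε * u (N' + (k + 1)) ≤ ε * (K * ψ x + K) := mul_le_mul_of_nonneg_left h6 hε0.le
    have h8 : ε * (K * ψ x) = c / 2 * ψ x := by rw [hε]; field_simp
    linarith [hΨu (k + 1)]

namespace WeightFunction

/-- A monotone function `h = o(ω)` is `o(σ)` for some weight function `σ = o(ω)`. -/
theorem exists_isLittleO (ω : WeightFunction) {h : ℝ → ℝ} (hm : MonotoneOn h (Set.Ici 0))
    (h0 : ∀ t, 0 ≤ t → 0 ≤ h t) (hh : h =o[atTop] ω.toFun) :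
    ∃ σ : WeightFunction, σ.toFun =o[atTop] ω.toFun ∧ h =o[atTop] σ.toFun := by
  obtain ⟨K, hK, hωK⟩ := ω.exists_affine_le (Real.exp_pos 1).le le_rfl
  have hexp := Real.tendsto_exp_atTop
  have hlog := Real.tendsto_log_atTop
  have hpsi : ∀ {g : ℝ → ℝ}, g =o[atTop] ω.toFun → (fun x => g (Real.exp x)) =o[atTop] ω.psi :=
    fun hg => hg.comp_tendsto hexp
  have hid : (fun x : ℝ => x) =o[atTop] ω.psi := by simpa using hpsi ω.gamma
  obtain ⟨Ψ, hΨc, hΨm, hΨconv, hΨ0, ⟨K', hK', hΨK⟩, hHΨ, hΨψ⟩ :=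
    -- The summand `x` forces `x = o(Ψ)`, which becomes condition (γ) for the new weight.
    exists_convexOn_isLittleO (ψ := ω.psi) (H := fun x => h (Real.exp x) + x) ω.delta
      ω.psi_monotoneOn ω.psi_zero hK
      (fun x _ => by
        have := hωK (Real.exp x) (Real.exp_pos x).le
        rwa [add_zero, ← Real.exp_add, add_comm 1 x] at this)
      hid
      (fun x hx y hy hxy => add_le_add (hm (Real.exp_pos x).le (Real.exp_pos y).le
        (Real.exp_le_exp.2 hxy)) hxy)
      (fun x hx => add_nonneg (h0 _ (Real.exp_pos x).le) hx)
      ((hpsi hh).add hid)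
  have hΨnn : ∀ x, 0 ≤ x → 0 ≤ Ψ x := fun x hx => hΨ0 ▸ hΨm Set.self_mem_Ici hx hx
  have hle : ∀ {g : ℝ → ℝ}, (∀ x, 0 ≤ x → 0 ≤ g x ∧ g x ≤ h (Real.exp x) + x) →
      (fun t => g (Real.log t)) =o[atTop] fun t => Ψ (Real.log t) := by
    intro g hg
    refine IsLittleO.comp_tendsto (f := g) (g := Ψ) (IsBigO.trans_isLittleO ?_ hHΨ) hlog
    refine IsBigO.of_bound 1 ?_
    filter_upwards [eventually_ge_atTop 0] with x hx
    rw [one_mul, Real.norm_of_nonneg (hg x hx).1]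
    exact (hg x hx).2.trans (le_abs_self _)
  have heq : (fun t => Ψ (Real.log (max 1 t))) =ᶠ[atTop] fun t => Ψ (Real.log t) := by
    filter_upwards [eventually_ge_atTop 1] with t ht
    rw [max_eq_right ht]
  have hlo : (fun t => Ψ (Real.log (max 1 t))) =o[atTop] ω.toFun := by
    refine heq.trans_isLittleO ?_
    refine (hΨψ.comp_tendsto hlog).congr' (EventuallyEq.refl _ _) ?_
    filter_upwards [eventually_gt_atTop 0] with t ht
    simp [psi, Real.exp_log ht]
  have hγ : Real.log =o[atTop] fun t => Ψ (Real.log (max 1 t)) :=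
    (hle (g := fun x => x) fun x hx => ⟨hx, le_add_of_nonneg_left (h0 _ (Real.exp_pos x).le)⟩).trans_eventuallyEq
      heq.symm
  have hΨt : Tendsto (fun t => Ψ (Real.log (max 1 t))) atTop atTop := by
    refine tendsto_atTop_mono' _ ?_ hlog
    filter_upwards [(isLittleO_iff.1 hγ) zero_lt_one] with t ht
    rw [one_mul, Real.norm_of_nonneg (hΨnn _ (Real.log_nonneg (le_max_left _ _)))] at ht
    exact (le_abs_self _).trans ht
  -- The truncation `max 1 t` makes the weight vanish on `[0, 1]`. Condition (α) follows from the
  -- growth of `Ψ` under unit shifts because `log 2 < 1`, and (β) is inherited from `ω`.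
  refine ⟨⟨fun t => Ψ (Real.log (max 1 t)), ?_, ?_, ?_, ?_, ?_, hγ, ?_⟩, hlo, ?_⟩
  · refine (hΨc.comp ?_).continuousOn
    exact Continuous.log (by fun_prop) fun t => (zero_lt_one.trans_le (le_max_left 1 t)).ne'
  · intro s _ t _ hst
    refine hΨm (Real.log_nonneg (le_max_left _ _)) (Real.log_nonneg (le_max_left _ _)) ?_
    exact Real.log_le_log (zero_lt_one.trans_le (le_max_left 1 s)) (max_le_max le_rfl hst)
  · intro t ht
    simp [max_eq_left ht.2, hΨ0]
  · refine IsBigO.of_bound (2 * K') ?_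
    filter_upwards [eventually_ge_atTop 1, hΨt.eventually_ge_atTop 1] with t ht h1
    rw [max_eq_right ht] at h1 ⊢
    rw [max_eq_right (by linarith)]
    have hl0 := Real.log_nonneg ht
    have hl : Real.log (2 * t) ≤ Real.log t + 1 := by
      rw [Real.log_mul two_ne_zero (by linarith), add_comm]
      linarith [Real.log_two_lt_d9]
    have hl2 : 0 ≤ Real.log (2 * t) := Real.log_nonneg (by linarith)
    rw [Real.norm_of_nonneg (hΨnn _ hl2), Real.norm_of_nonneg (hΨnn _ hl0)]
    have h2 := hΨm hl2 (Set.mem_Ici.2 (by linarith)) hl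
    have h3 := hΨK _ hl0
    nlinarith
  · exact hlo.isBigO.trans ω.beta
  · refine hΨconv.congr fun x hx => ?_
    rw [max_eq_right (Real.one_le_exp hx), Real.log_exp]
  · have h1 := hle (g := fun x => h (Real.exp x)) fun x hx =>
      ⟨h0 _ (Real.exp_pos x).le, le_add_of_nonneg_right hx⟩
    refine (h1.trans_eventuallyEq heq.symm).congr' ?_ (EventuallyEq.refl _ _)
    filter_upwards [eventually_gt_atTop 0] with t ht
    rw [Real.exp_log ht]

end WeightFunction

end

/-! ### Continuity of functionals on the inductive limit -/

noncomputable section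

namespace DL1

variable {ω : WeightFunction} {d : ℕ}

theorem continuous_ofStep (n : ℕ+) : Continuous (ofStep ω d n) :=
  continuous_sInf_rng.2 fun _ ht => ht.2.2.2 n

theorem exists_norm_ofStep_le (f : DL1 ω d →L[ℂ] ℂ) (n : ℕ+) :
    ∃ C : ℝ, 0 ≤ C ∧ ∀ φ : DL1Step ω d n, ‖f (ofStep ω d n φ)‖ ≤ C * ‖φ‖ := by
  let F : DL1Step ω d n →L[ℂ] ℂ :=
    ⟨f.toLinearMap ∘ₗ ofStep ω d n, f.continuous.comp (continuous_ofStep n)⟩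
  exact ⟨‖F‖, norm_nonneg _, fun φ => F.le_opNorm φ⟩

/-- The topology induced by `g` is a locally convex vector space topology making all inclusions
continuous, hence one of the topologies whose infimum defines the inductive limit. -/
theorem continuous_of_norm_ofStep_le (g : DL1 ω d →ₗ[ℂ] ℂ)
    (h : ∀ n : ℕ+, ∃ C : ℝ, ∀ φ : DL1Step ω d n, ‖g (ofStep ω d n φ)‖ ≤ C * ‖φ‖) :
    Continuous g := by
  refine continuous_le_dom (t₁ := TopologicalSpace.induced g inferInstance)
    (sInf_le ⟨?_, ?_, ?_, fun n => ?_⟩) continuous_induced_dom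
  · exact topologicalAddGroup_induced g
  · exact continuousSMul_induced g
  · exact LocallyConvexSpace.induced (g.restrictScalars ℝ)
  · rw [continuous_induced_rng]
    obtain ⟨C, hC⟩ := h n
    exact AddMonoidHomClass.continuous_of_bound (g ∘ₗ ofStep ω d n) C hC

end DL1

end

/-! ### Fréchet derivatives and multi-index derivatives -/

noncomputable section

section Multiindices

variable {d : ℕ} {φ : EuclideanSpace ℝ (Fin d) → ℂ}

section Symmetry

variable {E F : Type*} [NormedAddCommGroup E] [NormedSpace ℝ E] [NormedAddCommGroup F]
  [NormedSpace ℝ F] {φ : E → F}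

/-- The derivative of `φ` along the directions in a list. -/
def listDeriv (φ : E → F) (l : List E) : E → F := l.foldr (fun v f x => fderiv ℝ f x v) φ

theorem contDiff_listDeriv (hφ : ContDiff ℝ (⊤ : ℕ∞) φ) (l : List E) :
    ContDiff ℝ (⊤ : ℕ∞) (listDeriv φ l) := by
  induction l with
  | nil => exact hφ
  | cons v l ih => exact (ih.fderiv_right (m := (⊤ : ℕ∞)) (by simp)).clm_apply contDiff_const

/-- Permutations of lists are generated by adjacent swaps, so symmetry of the second derivative
suffices. -/
theorem listDeriv_perm (hφ : ContDiff ℝ (⊤ : ℕ∞) φ) {l l' : List E} (h : l.Perm l') :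
    listDeriv φ l = listDeriv φ l' := by
  induction h with
  | nil => rfl
  | cons v _ ih => exact congrArg (fun (f : E → F) x => fderiv ℝ f x v) ih
  | swap v w l =>
    funext x
    have hl := contDiff_listDeriv hφ l
    have hd : DifferentiableAt ℝ (fderiv ℝ (listDeriv φ l)) x :=
      (hl.fderiv_right (m := (⊤ : ℕ∞)) (by simp)).differentiable (by simp) x
    have hs : IsSymmSndFDerivAt ℝ (listDeriv φ l) x :=
      hl.contDiffAt.isSymmSndFDerivAt
        (by rw [minSmoothness_of_isRCLikeNormedField]; exact ENat.LEInfty.out)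
    change fderiv ℝ (fun y => fderiv ℝ (listDeriv φ l) y v) x w =
      fderiv ℝ (fun y => fderiv ℝ (listDeriv φ l) y w) x v
    rw [fderiv_clm_apply hd (differentiableAt_const _), fderiv_clm_apply hd (differentiableAt_const _)]
    simpa using hs w v
  | trans _ _ ih₁ ih₂ => exact ih₁.trans ih₂

theorem iteratedFDeriv_eq_listDeriv (hφ : ContDiff ℝ (⊤ : ℕ∞) φ) (k : ℕ) (v : Fin k → E) (x : E) :
    iteratedFDeriv ℝ k φ x v = listDeriv φ (List.ofFn v) x := by
  induction k generalizing x with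
  | zero => simp [listDeriv]
  | succ k ih =>
    rw [DifferentiableAt.iteratedFDeriv_succ_apply_left' (hφ.differentiable_iteratedFDeriv
      (by exact_mod_cast WithTop.coe_lt_top _) x)]
    simp only [ih]
    rw [List.ofFn_succ]
    rfl

/-- The iterated derivative of a smooth function is symmetric. -/
theorem iteratedFDeriv_comp_equiv (hφ : ContDiff ℝ (⊤ : ℕ∞) φ) (x : E)
    {k l : ℕ} (τ : Fin k ≃ Fin l) (v : Fin l → E) :
    iteratedFDeriv ℝ k φ x (v ∘ τ) = iteratedFDeriv ℝ l φ x v := by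
  obtain rfl : k = l := by simpa using Fintype.card_congr τ
  rw [iteratedFDeriv_eq_listDeriv hφ, iteratedFDeriv_eq_listDeriv hφ,
    listDeriv_perm hφ (Equiv.Perm.ofFn_comp_perm τ v)]

end Symmetry

/-- The multi-index counts how often each coordinate direction occurs in `r`; sorting the directions
is a permutation, which a symmetric derivative ignores. -/
theorem exists_mderiv_eq {k : ℕ} (r : Fin k → Fin d) :
    ∃ α : Fin d → ℕ, ∑ i, α i = k ∧ ∀ φ : EuclideanSpace ℝ (Fin d) → ℂ,
      ContDiff ℝ (⊤ : ℕ∞) φ → ∀ x,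
        iteratedFDeriv ℝ k φ x (fun i => EuclideanSpace.single (r i) 1) = mderiv α φ x := by
  let τ : Fin k ≃ Fin (∑ j, Fintype.card {i // r i = j}) :=
    (Equiv.sigmaFiberEquiv r).symm.trans
      ((Equiv.sigmaCongrRight fun j => Fintype.equivFin {i // r i = j}).trans finSigmaFinEquiv)
  refine ⟨fun j => Fintype.card {i // r i = j}, ?_, fun φ hφ x => ?_⟩
  · simpa using (Fintype.card_congr τ).symm
  · rw [mderiv, ← iteratedFDeriv_comp_equiv hφ x τ]
    congr 1
    funext i
    simp [τ, Equiv.sigmaFiberEquiv]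

theorem ContinuousMultilinearMap.norm_le_sum_single {k : ℕ} {F : Type*} [NormedAddCommGroup F]
    [NormedSpace ℝ F] (T : EuclideanSpace ℝ (Fin d) [×k]→L[ℝ] F) :
    ‖T‖ ≤ ∑ r : Fin k → Fin d, ‖T fun i => EuclideanSpace.single (r i) 1‖ := by
  refine T.opNorm_le_bound (Finset.sum_nonneg fun _ _ => norm_nonneg _) fun m => ?_
  have hm : m = fun i => ∑ j, m i j • EuclideanSpace.single j (1 : ℝ) := by
    funext i
    ext l
    simp [Finset.sum_apply, Pi.single_apply]
  conv_lhs => rw [hm]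
  rw [ContinuousMultilinearMap.map_sum, Finset.sum_mul]
  refine (norm_sum_le _ _).trans (Finset.sum_le_sum fun r _ => ?_)
  rw [ContinuousMultilinearMap.map_smul_univ, norm_smul, mul_comm, norm_prod]
  gcongr with i
  exact PiLp.norm_apply_le (m i) (r i)

theorem norm_mderiv_le (α : Fin d → ℕ) (φ : EuclideanSpace ℝ (Fin d) → ℂ)
    (x : EuclideanSpace ℝ (Fin d)) : ‖mderiv α φ x‖ ≤ ‖iteratedFDeriv ℝ (∑ i, α i) φ x‖ := by
  refine (ContinuousMultilinearMap.le_opNorm _ _).trans_eq ?_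
  simp

theorem continuous_mderiv (hφ : ContDiff ℝ (⊤ : ℕ∞) φ) (α : Fin d → ℕ) :
    Continuous (mderiv α φ) := by
  have h := hφ.continuous_iteratedFDeriv (m := ∑ i, α i) (by exact_mod_cast le_top)
  exact (ContinuousMultilinearMap.apply ℝ (fun _ => EuclideanSpace ℝ (Fin d)) ℂ _).continuous.comp h

theorem integrable_iteratedFDeriv (hφ : ContDiff ℝ (⊤ : ℕ∞) φ)
    (hi : ∀ α : Fin d → ℕ, Integrable (mderiv α φ)) (k : ℕ) :
    Integrable (iteratedFDeriv ℝ k φ) := by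
  have h : Integrable fun x => ∑ r : Fin k → Fin d,
      ‖iteratedFDeriv ℝ k φ x fun i => EuclideanSpace.single (r i) 1‖ := by
    refine integrable_finsetSum _ fun r _ => ?_
    obtain ⟨α, -, hα⟩ := exists_mderiv_eq r
    simp only [hα φ hφ]
    exact (hi α).norm
  refine h.mono' (hφ.continuous_iteratedFDeriv (by exact_mod_cast le_top)).aestronglyMeasurable ?_
  exact .of_forall fun x => ContinuousMultilinearMap.norm_le_sum_single _

/-- The factor `d ^ k` counts the tuples of basis vectors. Being geometric, it only rescales the
frequency in the decay estimates. -/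
theorem integral_norm_iteratedFDeriv_le (hφ : ContDiff ℝ (⊤ : ℕ∞) φ)
    (hi : ∀ α : Fin d → ℕ, Integrable (mderiv α φ)) (k : ℕ) {A : ℝ}
    (hA : ∀ α : Fin d → ℕ, ∑ i, α i = k → ∫ x, ‖mderiv α φ x‖ ≤ A) :
    ∫ x, ‖iteratedFDeriv ℝ k φ x‖ ≤ d ^ k * A := by
  have h : ∀ r : Fin k → Fin d, Integrable (fun x =>
      ‖iteratedFDeriv ℝ k φ x fun i => EuclideanSpace.single (r i) 1‖) ∧
      ∫ x, ‖iteratedFDeriv ℝ k φ x fun i => EuclideanSpace.single (r i) 1‖ ≤ A := fun r => by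
    obtain ⟨α, hk, hα⟩ := exists_mderiv_eq r
    simp only [hα φ hφ]
    exact ⟨(hi α).norm, hA α hk⟩
  calc ∫ x, ‖iteratedFDeriv ℝ k φ x‖
      ≤ ∫ x, ∑ r : Fin k → Fin d,
          ‖iteratedFDeriv ℝ k φ x fun i => EuclideanSpace.single (r i) 1‖ :=
        integral_mono (integrable_iteratedFDeriv hφ hi k).norm
          (integrable_finsetSum _ fun r _ => (h r).1)
          fun x => ContinuousMultilinearMap.norm_le_sum_single _
    _ = ∑ r : Fin k → Fin d, ∫ x, ‖iteratedFDeriv ℝ k φ x fun i => EuclideanSpace.single (r i) 1‖ :=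
        integral_finsetSum _ fun r _ => (h r).1
    _ ≤ ∑ r : Fin k → Fin d, A := Finset.sum_le_sum fun r _ => (h r).2
    _ = d ^ k * A := by simp

end Multiindices

end

/-! ### Convolutions, and decay of Fourier transforms -/

noncomputable section

section Convolution

variable {E V : Type*} [NormedAddCommGroup E] [InnerProductSpace ℝ E] [FiniteDimensional ℝ E]
  [MeasurableSpace E] [BorelSpace E] [NormedAddCommGroup V] [NormedSpace ℂ V]

theorem integrable_smul_comp_sub {ψ : E → ℂ} (hψ : Integrable ψ) {H : E → V} (hH : Continuous H)
    {C : ℝ} (hC : ∀ t, ‖H t‖ ≤ C) (x : E) : Integrable fun s => ψ s • H (x - s) := by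
  refine (hψ.norm.mul_const C).mono' (hψ.1.smul
    (hH.comp (continuous_const.sub continuous_id)).aestronglyMeasurable) (.of_forall fun s => ?_)
  rw [norm_smul]
  exact mul_le_mul_of_nonneg_left (hC _) (norm_nonneg _)

theorem hasFDerivAt_integral_smul_comp_sub {ψ : E → ℂ} (hψ : Integrable ψ) {H : E → V}
    (hH : ContDiff ℝ 1 H) {C₀ C₁ : ℝ} (h₀ : ∀ t, ‖H t‖ ≤ C₀) (h₁ : ∀ t, ‖fderiv ℝ H t‖ ≤ C₁) (x : E) :
    HasFDerivAt (fun x => ∫ s, ψ s • H (x - s)) (∫ s, ψ s • fderiv ℝ H (x - s)) x := by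
  have hd := hH.continuous_fderiv (by simp)
  refine hasFDerivAt_integral_of_dominated_of_fderiv_le (s := Set.univ) univ_mem
    (F' := fun x s => ψ s • fderiv ℝ H (x - s)) (bound := fun s => ‖ψ s‖ * C₁)
    (.of_forall fun y => (integrable_smul_comp_sub hψ hH.continuous h₀ y).1)
    (integrable_smul_comp_sub hψ hH.continuous h₀ x)
    (integrable_smul_comp_sub hψ hd h₁ x).1 (.of_forall fun s y _ => ?_)
    (hψ.norm.mul_const C₁) (.of_forall fun s y _ => ?_)
  · rw [norm_smul]
    exact mul_le_mul_of_nonneg_left (h₁ _) (norm_nonneg _)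
  · exact (((hH.differentiable (by simp) (y - s)).hasFDerivAt).comp y
      (hasFDerivAt_sub_const s)).const_smul (ψ s)

variable {ψ G : E → ℂ}

/-- All derivatives fall on `G`, whose derivatives are bounded, so `ψ` need only be integrable. -/
theorem iteratedFDeriv_integral_smul_comp_sub (hψ : Integrable ψ) (hG : ContDiff ℝ (⊤ : ℕ∞) G)
    (hb : ∀ j, ∃ C, ∀ t, ‖iteratedFDeriv ℝ j G t‖ ≤ C) (k : ℕ) :
    iteratedFDeriv ℝ k (fun x => ∫ s, ψ s • G (x - s)) =
      fun x => ∫ s, ψ s • iteratedFDeriv ℝ k G (x - s) := by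
  induction k with
  | zero =>
    funext x
    ext v
    obtain ⟨C, hC⟩ := hb 0
    rw [ContinuousMultilinearMap.integral_apply (integrable_smul_comp_sub hψ
      (hG.continuous_iteratedFDeriv (by simp)) hC x)]
    simp
  | succ k ih =>
    obtain ⟨C₀, h₀⟩ := hb k
    obtain ⟨C₁, h₁⟩ := hb (k + 1)
    funext x
    have hH : ContDiff ℝ 1 (iteratedFDeriv ℝ k G) :=
      hG.iteratedFDeriv_right (by exact_mod_cast le_top)
    have h₁' : ∀ t, ‖fderiv ℝ (iteratedFDeriv ℝ k G) t‖ ≤ C₁ := fun t =>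
      norm_fderiv_iteratedFDeriv.trans_le (h₁ t)
    rw [iteratedFDeriv_succ_eq_comp_left, ih, Function.comp_apply,
      (hasFDerivAt_integral_smul_comp_sub hψ hH h₀ h₁' x).fderiv]
    have hi := integrable_smul_comp_sub hψ (hH.continuous_fderiv (by simp)) h₁' x
    ext v
    rw [ContinuousMultilinearMap.integral_apply
      (integrable_smul_comp_sub hψ (hG.continuous_iteratedFDeriv (by exact_mod_cast le_top)) h₁ x)]
    change (∫ s, ψ s • fderiv ℝ (iteratedFDeriv ℝ k G) (x - s)) (v 0) (Fin.tail v) = _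
    rw [ContinuousLinearMap.integral_apply hi, ContinuousMultilinearMap.integral_apply
      (hi.apply_continuousLinearMap (v 0))]
    rfl

theorem contDiff_integral_smul_comp_sub (hψ : Integrable ψ) (hG : ContDiff ℝ (⊤ : ℕ∞) G)
    (hb : ∀ j, ∃ C, ∀ t, ‖iteratedFDeriv ℝ j G t‖ ≤ C) :
    ContDiff ℝ (⊤ : ℕ∞) (fun x => ∫ s, ψ s • G (x - s)) := by
  refine contDiff_of_differentiable_iteratedFDeriv fun k _ => ?_
  rw [iteratedFDeriv_integral_smul_comp_sub hψ hG hb]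
  obtain ⟨C₀, h₀⟩ := hb k
  obtain ⟨C₁, h₁⟩ := hb (k + 1)
  exact fun x => (hasFDerivAt_integral_smul_comp_sub hψ
    (hG.iteratedFDeriv_right (by exact_mod_cast le_top)) h₀
    (fun t => norm_fderiv_iteratedFDeriv.trans_le (h₁ t)) x).differentiableAt

end Convolution

section Derivatives

variable {E F : Type*} [NormedAddCommGroup E] [NormedSpace ℝ E] [NormedAddCommGroup F]
  [NormedSpace ℝ F]

theorem norm_iteratedFDeriv_clm_comp {W : Type*} [NormedAddCommGroup W] [NormedSpace ℝ W]
    (L : F →L[ℝ] W) (hL : ∀ v, ‖L v‖ = ‖v‖) {f : E → F} (hf : ContDiff ℝ (⊤ : ℕ∞) f) (m : ℕ) (x : E) :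
    ‖iteratedFDeriv ℝ m (fun y => L (f y)) x‖ = ‖iteratedFDeriv ℝ m f x‖ :=
  (⟨L.toLinearMap, hL⟩ : F →ₗᵢ[ℝ] W).norm_iteratedFDeriv_comp_left (f := f) (n := (⊤ : ℕ∞))
    hf.contDiffAt (by exact_mod_cast le_top)

theorem norm_iteratedFDeriv_iteratedFDeriv {f : E → F} (hf : ContDiff ℝ (⊤ : ℕ∞) f) (m i : ℕ)
    (x : E) : ‖iteratedFDeriv ℝ m (iteratedFDeriv ℝ i f) x‖ = ‖iteratedFDeriv ℝ (m + i) f x‖ := by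
  induction i generalizing m with
  | zero =>
    exact (LinearIsometryEquiv.norm_iteratedFDeriv_comp_left
      (continuousMultilinearCurryFin0 ℝ E F).symm f x m)
  | succ i ih =>
    have h : iteratedFDeriv ℝ (i + 1) f = fun y => (continuousMultilinearCurryLeftEquiv ℝ
      (fun _ : Fin (i + 1) => E) F).symm (fderiv ℝ (iteratedFDeriv ℝ i f) y) := rfl
    have hs : ContDiff ℝ (⊤ : ℕ∞) (fderiv ℝ (iteratedFDeriv ℝ i f)) :=
      (hf.iteratedFDeriv_right (m := (⊤ : ℕ∞)) (by exact_mod_cast le_top)).fderiv_right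
        (m := (⊤ : ℕ∞)) (by simp)
    have h' := norm_iteratedFDeriv_clm_comp (F := E →L[ℝ] (E [×i]→L[ℝ] F))
      (W := E [×(i + 1)]→L[ℝ] F)
      ((continuousMultilinearCurryLeftEquiv ℝ (fun _ : Fin (i + 1) => E)
        F).symm.toContinuousLinearEquiv.toContinuousLinearMap)
      (fun v => LinearIsometryEquiv.norm_map _ v) hs m x
    rw [h]
    refine Eq.trans h' ?_
    rw [norm_iteratedFDeriv_fderiv, ih, add_right_comm, add_assoc]

theorem norm_iteratedFDeriv_comp_const_sub (f : E → F) (j : ℕ) (x t : E) :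
    ‖iteratedFDeriv ℝ j (fun t => f (x - t)) t‖ = ‖iteratedFDeriv ℝ j f (x - t)‖ := by
  have h : (fun t => f (x - t)) = (fun u => f (x + u)) ∘ LinearIsometryEquiv.neg ℝ := by
    funext u
    simp [sub_eq_add_neg]
  rw [h, LinearIsometryEquiv.norm_iteratedFDeriv_comp_right, iteratedFDeriv_comp_add_left]
  simp [sub_eq_add_neg]

end Derivatives

section Decay

open Real FourierTransform VectorFourier

variable {E : Type*} [NormedAddCommGroup E] [InnerProductSpace ℝ E] [FiniteDimensional ℝ E]
  [MeasurableSpace E] [BorelSpace E]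

/-- The transform of the `m`-th derivative is a multilinear map. Evaluating it at `(k, …, k)` gives
`‖k‖ ^ (2 * m)`, of which the operator norm bound takes back `‖k‖ ^ m`. -/
theorem norm_fourier_mul_pow_le {V : Type*} [NormedAddCommGroup V] [NormedSpace ℂ V] {u : E → V}
    (hu : ContDiff ℝ (⊤ : ℕ∞) u) (hi : ∀ n : ℕ, Integrable (iteratedFDeriv ℝ n u)) (m : ℕ) (k : E) :
    (2 * π * ‖k‖) ^ m * ‖𝓕 u k‖ ≤ ∫ t, ‖iteratedFDeriv ℝ m u t‖ := by
  have h1 : ‖𝓕 (iteratedFDeriv ℝ m u) k‖ ≤ ∫ t, ‖iteratedFDeriv ℝ m u t‖ :=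
    norm_fourierIntegral_le_integral_norm _ _ _ _ _
  rw [Real.fourier_iteratedFDeriv (N := (⊤ : ℕ∞)) hu (fun n _ => hi n) (by simp)] at h1
  refine le_trans ?_ h1
  have h2 := (fourierPowSMulRight (-innerSL ℝ) (𝓕 u) k m).le_opNorm fun _ => k
  rw [fourierPowSMulRight_apply, Finset.prod_const, Finset.prod_const, Finset.card_univ,
    Fintype.card_fin] at h2
  rcases eq_or_ne k 0 with rfl | hk
  · rcases eq_or_ne m 0 with rfl | hm
    · simpa using h2
    · simp [hm]
  · have hk' : 0 < ‖k‖ := norm_pos_iff.2 hk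
    refine le_of_mul_le_mul_right (le_trans (le_of_eq ?_) h2) (pow_pos hk' m)
    have h3 : (-innerSL ℝ) k k = -(‖k‖ ^ 2) := by simp
    rw [h3]
    simp [norm_smul, abs_of_pos pi_pos, mul_pow]
    ring

end Decay

end

/-! ### Wave packets -/

noncomputable section

section WavePacket

open Real FourierTransform

variable {E : Type*} [NormedAddCommGroup E] [InnerProductSpace ℝ E]

/-- The character `x ↦ exp(2πi⟨x, k⟩)`. -/
def planeWave (k x : E) : ℂ := Complex.exp ((2 * π * inner ℝ x k : ℝ) * Complex.I)

theorem norm_planeWave (k x : E) : ‖planeWave k x‖ = 1 := Complex.norm_exp_ofReal_mul_I _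

theorem planeWave_add (k x y : E) : planeWave k (x + y) = planeWave k x * planeWave k y := by
  rw [planeWave, planeWave, planeWave, ← Complex.exp_add]
  congr 1
  rw [inner_add_left]
  push_cast
  ring

/-- The exponent of `planeWave` as a continuous linear map. -/
def planeWaveCLM (k : E) : E →L[ℝ] ℂ :=
  ((2 * π * Complex.I : ℂ)) • Complex.ofRealCLM.comp (innerSL ℝ k)

theorem planeWave_eq (k : E) : planeWave k = fun x => Complex.exp (planeWaveCLM k x) := by
  funext x
  simp only [planeWave, planeWaveCLM, smul_apply, smul_eq_mul,
    ContinuousLinearMap.comp_apply, innerSL_apply_apply, Complex.ofRealCLM_apply]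
  rw [real_inner_comm]
  push_cast
  congr 1
  ring

theorem norm_planeWaveCLM_le (k : E) : ‖planeWaveCLM k‖ ≤ 2 * π * ‖k‖ := by
  refine ContinuousLinearMap.opNorm_le_bound _ (by positivity) fun x => ?_
  simp only [planeWaveCLM, smul_apply, ContinuousLinearMap.comp_apply,
    innerSL_apply_apply, Complex.ofRealCLM_apply, norm_smul, norm_mul, Complex.norm_real,
    Complex.norm_I, Complex.norm_ofNat, mul_one, norm_of_nonneg pi_pos.le, mul_assoc]
  gcongr
  exact norm_inner_le_norm k x

theorem contDiff_planeWave (k : E) {n : WithTop ℕ∞} : ContDiff ℝ n (planeWave k) := by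
  rw [planeWave_eq]
  exact (planeWaveCLM k).contDiff.cexp

theorem norm_iteratedFDeriv_planeWave_le (k : E) (i : ℕ) (x : E) :
    ‖iteratedFDeriv ℝ i (planeWave k) x‖ ≤ (2 * π * ‖k‖) ^ i := by
  induction i generalizing x with
  | zero => simp [norm_planeWave]
  | succ i ih =>
    let S : ℂ →L[ℝ] (E →L[ℝ] ℂ) :=
      (ContinuousLinearMap.toSpanSingleton ℂ (planeWaveCLM k)).restrictScalars ℝ
    have hS : ‖S‖ ≤ 2 * π * ‖k‖ := by
      refine ContinuousLinearMap.opNorm_le_bound _ (by positivity) fun c => ?_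
      change ‖c • planeWaveCLM k‖ ≤ _
      rw [norm_smul, mul_comm]
      exact mul_le_mul_of_nonneg_right (norm_planeWaveCLM_le k) (norm_nonneg c)
    have h : fderiv ℝ (planeWave k) = S ∘ planeWave k := by
      rw [planeWave_eq]
      funext y
      exact ((planeWaveCLM k).hasFDerivAt (x := y)).cexp.fderiv
    rw [← norm_iteratedFDeriv_fderiv, h, pow_succ']
    exact (S.norm_iteratedFDeriv_comp_left (N := i) (contDiff_planeWave k).contDiffAt le_rfl).trans
      (mul_le_mul hS (ih x) (norm_nonneg _) (by positivity))

variable [FiniteDimensional ℝ E] [MeasurableSpace E] [BorelSpace E]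

/-- The part of `φ` near the frequency `-k`, localized with the window `G`. -/
def wavePacket (G : E → ℂ) (k : E) (φ : E → ℂ) (x : E) : ℂ :=
  ∫ s, φ s * (planeWave k (s - x) * G (x - s))

/-- Splitting off the modulation in `x` leaves an ordinary convolution, to which differentiation
under the integral and the Leibniz rule apply. -/
theorem wavePacket_eq (G : E → ℂ) (k : E) (φ : E → ℂ) :
    wavePacket G k φ = fun x => planeWave k (-x) * ∫ s, (φ s * planeWave k s) • G (x - s) := by
  funext x
  rw [wavePacket, ← integral_const_mul]
  refine integral_congr_ae (.of_forall fun s => ?_)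
  simp only [sub_eq_add_neg, planeWave_add, smul_eq_mul]
  ring

/-- The binomial sum `∑ⱼ (m choose j) B^(m-j) (v * ‖Dʲφ‖)(x)`. -/
def binomialMajorant (v : E → ℝ) (B : ℝ) (φ : E → ℂ) (m : ℕ) (x : E) : ℝ :=
  ∑ j ∈ Finset.range (m + 1),
    (m.choose j : ℝ) * B ^ (m - j) * ∫ t, v t * ‖iteratedFDeriv ℝ j φ (x - t)‖

variable {G : E → ℂ} {v : E → ℝ} {B C : ℝ} {φ : E → ℂ}

theorem integrable_mul_norm_iteratedFDeriv_sub (hv : Continuous v) (hv0 : ∀ t, 0 ≤ v t)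
    (hv1 : ∀ t, v t ≤ 1) {j : ℕ} (hi : Integrable (iteratedFDeriv ℝ j φ)) (x : E) :
    Integrable fun t => v t * ‖iteratedFDeriv ℝ j φ (x - t)‖ := by
  refine (hi.comp_sub_left x).norm.bdd_mul (c := 1) hv.aestronglyMeasurable (.of_forall fun t => ?_)
  rw [norm_of_nonneg (hv0 t)]
  exact hv1 t

/-- After `s = x - t` the integral is, up to a unimodular factor, the Fourier transform at `k` of `t
↦ φ (x - t) • DⁱG(t)`. Decay in `k` comes from `m` derivatives of this product. Keeping the weight
`v` inside the bound preserves integrability in `x`. -/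
theorem norm_integral_planeWave_smul_le (hG : ContDiff ℝ (⊤ : ℕ∞) G) (hv : Continuous v)
    (hv0 : ∀ t, 0 ≤ v t) (hv1 : ∀ t, v t ≤ 1)
    (hGb : ∀ l t, ‖iteratedFDeriv ℝ l G t‖ ≤ C * B ^ l * v t)
    (hφ : ContDiff ℝ (⊤ : ℕ∞) φ) (hi : ∀ j, Integrable (iteratedFDeriv ℝ j φ)) (k x : E)
    (m i : ℕ) :
    (2 * π * ‖k‖) ^ m * ‖∫ s, (φ s * planeWave k s) • iteratedFDeriv ℝ i G (x - s)‖ ≤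
      C * B ^ i * binomialMajorant v B φ m x := by
  set u : E → E [×i]→L[ℝ] ℂ := fun t => φ (x - t) • iteratedFDeriv ℝ i G t with hu
  have hφx : ContDiff ℝ (⊤ : ℕ∞) fun t => φ (x - t) := hφ.comp (contDiff_const.sub contDiff_id)
  have hGi : ContDiff ℝ (⊤ : ℕ∞) (iteratedFDeriv ℝ i G) :=
    hG.iteratedFDeriv_right (by exact_mod_cast le_top)
  have hus : ContDiff ℝ (⊤ : ℕ∞) u := hφx.smul hGi
  have hI := fun j => integrable_mul_norm_iteratedFDeriv_sub hv hv0 hv1 (hi j) x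
  have hbound : ∀ (n : ℕ) (t : E), ‖iteratedFDeriv ℝ n u t‖ ≤ ∑ j ∈ Finset.range (n + 1),
      C * B ^ i * ((n.choose j : ℝ) * B ^ (n - j) * (v t * ‖iteratedFDeriv ℝ j φ (x - t)‖)) := by
    intro n t
    refine (norm_iteratedFDeriv_smul_le hφx hGi t (by exact_mod_cast le_top)).trans
      (Finset.sum_le_sum fun j _ => ?_)
    rw [norm_iteratedFDeriv_comp_const_sub, norm_iteratedFDeriv_iteratedFDeriv hG]
    calc (n.choose j : ℝ) * ‖iteratedFDeriv ℝ j φ (x - t)‖ * ‖iteratedFDeriv ℝ (n - j + i) G t‖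
        ≤ (n.choose j : ℝ) * ‖iteratedFDeriv ℝ j φ (x - t)‖ * (C * B ^ (n - j + i) * v t) := by
          gcongr
          exact hGb _ _
      _ = _ := by rw [pow_add]; ring
  have hbi : ∀ n : ℕ, Integrable fun t => ∑ j ∈ Finset.range (n + 1),
      C * B ^ i * ((n.choose j : ℝ) * B ^ (n - j) * (v t * ‖iteratedFDeriv ℝ j φ (x - t)‖)) :=
    fun n => integrable_finsetSum _ fun j _ => ((hI j).const_mul _).const_mul _
  have hui : ∀ n : ℕ, Integrable (iteratedFDeriv ℝ n u) := fun n =>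
    (hbi n).mono' (hus.continuous_iteratedFDeriv (by exact_mod_cast le_top)).aestronglyMeasurable
      (.of_forall fun t => hbound n t)
  have heq : ∫ s, (φ s * planeWave k s) • iteratedFDeriv ℝ i G (x - s) =
      planeWave k x • 𝓕 u k := by
    rw [Real.fourier_eq', ← integral_smul,
      ← integral_sub_left_eq_self (fun s => (φ s * planeWave k s) • iteratedFDeriv ℝ i G (x - s))
        volume x]
    refine integral_congr_ae (.of_forall fun t => ?_)
    have h1 : Complex.exp (((-2 * π * inner ℝ t k : ℝ) : ℂ) * Complex.I) = planeWave k (-t) := by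
      rw [planeWave, inner_neg_left]
      congr 3
      ring
    simp only [sub_sub_cancel, hu]
    rw [h1, smul_smul, smul_smul, sub_eq_add_neg, planeWave_add]
    congr 1
    ring
  rw [heq, norm_smul, norm_planeWave, one_mul]
  refine (norm_fourier_mul_pow_le hus hui m k).trans ?_
  refine (integral_mono (hui m).norm (hbi m) (hbound m)).trans_eq ?_
  rw [integral_finsetSum _ fun j _ => ((hI j).const_mul _).const_mul _, binomialMajorant,
    Finset.mul_sum]
  simp only [integral_const_mul]

theorem contDiff_wavePacket (hG : ContDiff ℝ (⊤ : ℕ∞) G)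
    (hb : ∀ j, ∃ C, ∀ t, ‖iteratedFDeriv ℝ j G t‖ ≤ C) (hφ : Integrable φ) (k : E) :
    ContDiff ℝ (⊤ : ℕ∞) (wavePacket G k φ) := by
  rw [wavePacket_eq]
  have hψ : Integrable fun s => φ s * planeWave k s :=
    hφ.mul_bdd (c := 1) (contDiff_planeWave k (n := 0)).continuous.aestronglyMeasurable
      (.of_forall fun s => (norm_planeWave k s).le)
  exact ((contDiff_planeWave k).comp contDiff_neg).mul (contDiff_integral_smul_comp_sub hψ hG hb)

/-- By the Leibniz rule each derivative costs `2π‖k‖` on the modulation or `B` on the window; the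
binomial theorem collects these costs into one power. The exponent `m` of the decay stays free. -/
theorem norm_iteratedFDeriv_wavePacket_le (hG : ContDiff ℝ (⊤ : ℕ∞) G) (hv : Continuous v)
    (hv0 : ∀ t, 0 ≤ v t) (hv1 : ∀ t, v t ≤ 1) (hC : 0 ≤ C) (hB : 0 ≤ B)
    (hGb : ∀ l t, ‖iteratedFDeriv ℝ l G t‖ ≤ C * B ^ l * v t)
    (hφ : ContDiff ℝ (⊤ : ℕ∞) φ) (hi : ∀ j, Integrable (iteratedFDeriv ℝ j φ)) (k x : E)
    (m l : ℕ) :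
    (2 * π * ‖k‖) ^ m * ‖iteratedFDeriv ℝ l (wavePacket G k φ) x‖ ≤
      C * (2 * π * ‖k‖ + B) ^ l * binomialMajorant v B φ m x := by
  have hb : ∀ j, ∃ C, ∀ t, ‖iteratedFDeriv ℝ j G t‖ ≤ C := fun j => ⟨C * B ^ j, fun t =>
    (hGb j t).trans (mul_le_of_le_one_right (by positivity) (hv1 t))⟩
  have hφi : Integrable φ := by
    refine (hi 0).norm.mono' hφ.continuous.aestronglyMeasurable (.of_forall fun t => ?_)
    rw [norm_iteratedFDeriv_zero]
  have hψ : Integrable fun s => φ s * planeWave k s :=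
    hφi.mul_bdd (c := 1) (contDiff_planeWave k (n := 0)).continuous.aestronglyMeasurable
      (.of_forall fun s => (norm_planeWave k s).le)
  have hM := contDiff_integral_smul_comp_sub hψ hG hb
  have hD := iteratedFDeriv_integral_smul_comp_sub hψ hG hb
  have he : ContDiff ℝ (⊤ : ℕ∞) fun x => planeWave k (-x) := (contDiff_planeWave k).comp contDiff_neg
  have hei : ∀ i, ‖iteratedFDeriv ℝ i (fun x => planeWave k (-x)) x‖ ≤ (2 * π * ‖k‖) ^ i := by
    intro i
    have h := norm_iteratedFDeriv_comp_const_sub (planeWave k) i 0 x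
    simp only [zero_sub] at h
    exact h.trans_le (norm_iteratedFDeriv_planeWave_le k i _)
  rw [wavePacket_eq]
  calc (2 * π * ‖k‖) ^ m * ‖iteratedFDeriv ℝ l
        (fun x => planeWave k (-x) * ∫ s, (φ s * planeWave k s) • G (x - s)) x‖
      ≤ (2 * π * ‖k‖) ^ m * ∑ i ∈ Finset.range (l + 1), (l.choose i : ℝ) *
          ‖iteratedFDeriv ℝ i (fun x => planeWave k (-x)) x‖ *
          ‖iteratedFDeriv ℝ (l - i) (fun x => ∫ s, (φ s * planeWave k s) • G (x - s)) x‖ := by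
        gcongr
        exact norm_iteratedFDeriv_mul_le he hM x (by exact_mod_cast le_top)
    _ ≤ ∑ i ∈ Finset.range (l + 1), (l.choose i : ℝ) * (2 * π * ‖k‖) ^ i *
          (C * B ^ (l - i) * binomialMajorant v B φ m x) := by
        rw [Finset.mul_sum]
        refine Finset.sum_le_sum fun i _ => ?_
        rw [mul_left_comm, hD (l - i)]
        refine mul_le_mul ?_ (norm_integral_planeWave_smul_le hG hv hv0 hv1 hGb hφ hi k x m _)
          (by positivity) (by positivity)
        gcongr
        exact hei i
    _ = _ := by
        rw [add_pow, Finset.mul_sum, Finset.sum_mul]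
        refine Finset.sum_congr rfl fun i _ => ?_
        ring

theorem binomialMajorant_le (hv : Continuous v) (hv0 : ∀ t, 0 ≤ v t) (hv1 : ∀ t, v t ≤ 1)
    (hB : 0 ≤ B) (hi : ∀ j, Integrable (iteratedFDeriv ℝ j φ)) (m : ℕ) (x : E) :
    binomialMajorant v B φ m x ≤ ∑ j ∈ Finset.range (m + 1),
      (m.choose j : ℝ) * B ^ (m - j) * ∫ t, ‖iteratedFDeriv ℝ j φ t‖ := by
  refine Finset.sum_le_sum fun j _ => mul_le_mul_of_nonneg_left ?_ (by positivity)
  rw [← integral_sub_left_eq_self (fun t => ‖iteratedFDeriv ℝ j φ t‖) volume x]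
  exact integral_mono (integrable_mul_norm_iteratedFDeriv_sub hv hv0 hv1 (hi j) x)
    ((hi j).comp_sub_left x).norm fun t => mul_le_of_le_one_left (norm_nonneg _) (hv1 t)

theorem integrable_binomialMajorant (hvi : Integrable v)
    (hi : ∀ j, Integrable (iteratedFDeriv ℝ j φ)) (m : ℕ) :
    Integrable (binomialMajorant v B φ m) :=
  integrable_finsetSum _ fun j _ => Integrable.const_mul
    (hvi.integrable_convolution (ContinuousLinearMap.mul ℝ ℝ) (hi j).norm) _

theorem integral_binomialMajorant (hvi : Integrable v)
    (hi : ∀ j, Integrable (iteratedFDeriv ℝ j φ)) (m : ℕ) :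
    ∫ x, binomialMajorant v B φ m x = (∫ t, v t) * ∑ j ∈ Finset.range (m + 1),
      (m.choose j : ℝ) * B ^ (m - j) * ∫ t, ‖iteratedFDeriv ℝ j φ t‖ := by
  unfold binomialMajorant
  have hc : ∀ j, Integrable fun x => ∫ t, v t * ‖iteratedFDeriv ℝ j φ (x - t)‖ := fun j =>
    hvi.integrable_convolution (ContinuousLinearMap.mul ℝ ℝ) (hi j).norm
  rw [integral_finsetSum _ fun j _ => Integrable.const_mul (hc j) _, Finset.mul_sum]
  refine Finset.sum_congr rfl fun j _ => ?_
  have h := integral_convolution (ContinuousLinearMap.mul ℝ ℝ) hvi (hi j).norm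
    (μ := volume) (ν := volume)
  simp only [convolution, ContinuousLinearMap.mul_apply'] at h
  rw [integral_const_mul, h]
  ring

end WavePacket

end

/-! ### Polynomial weights, and Fourier transforms of bumps -/

noncomputable section

section Weights

open Module

variable {E : Type*} [NormedAddCommGroup E]

/-- The weight `(1 + ‖t‖)^(-N)`. -/
def invOneAddNorm (N : ℕ) (t : E) : ℝ := ((1 + ‖t‖) ^ N)⁻¹

theorem invOneAddNorm_pos (N : ℕ) (t : E) : 0 < invOneAddNorm N t := by
  unfold invOneAddNorm
  positivity

theorem invOneAddNorm_le_one (N : ℕ) (t : E) : invOneAddNorm N t ≤ 1 :=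
  inv_le_one_of_one_le₀ (one_le_pow₀ (by linarith [norm_nonneg t]))

theorem continuous_invOneAddNorm (N : ℕ) : Continuous (invOneAddNorm N : E → ℝ) :=
  Continuous.inv₀ (by fun_prop) fun t => by positivity

theorem integrable_invOneAddNorm [NormedSpace ℝ E] [FiniteDimensional ℝ E] [MeasurableSpace E]
    [BorelSpace E] (μ : Measure E) [μ.IsAddHaarMeasure] :
    Integrable (invOneAddNorm (finrank ℝ E + 1) : E → ℝ) μ := by
  have h := integrable_one_add_norm (E := E) (μ := μ) (r := (finrank ℝ E + 1 : ℕ))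
    (by exact_mod_cast Nat.lt_succ_self _)
  refine h.congr (.of_forall fun t => ?_)
  simp only [invOneAddNorm]
  rw [Real.rpow_neg (by positivity), Real.rpow_natCast]

theorem le_mul_invOneAddNorm {N : ℕ} {t : E} {X A A' : ℝ} (hX : 0 ≤ X) (h0 : X ≤ A)
    (hN : ‖t‖ ^ N * X ≤ A') : X ≤ 2 ^ N * (A + A') * invOneAddNorm N t := by
  rw [invOneAddNorm, ← div_eq_mul_inv, le_div_iff₀ (by positivity)]
  have h1 : (1 + ‖t‖) ^ N ≤ 2 ^ N * (1 + ‖t‖ ^ N) := by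
    have h2 : 1 + ‖t‖ ≤ 2 * max 1 ‖t‖ := by
      linarith [le_max_left 1 ‖t‖, le_max_right 1 ‖t‖]
    calc (1 + ‖t‖) ^ N ≤ (2 * max 1 ‖t‖) ^ N := by gcongr
      _ = 2 ^ N * max 1 ‖t‖ ^ N := mul_pow _ _ _
      _ ≤ 2 ^ N * (1 + ‖t‖ ^ N) := by
        gcongr
        rcases max_cases 1 ‖t‖ with ⟨h, _⟩ | ⟨h, _⟩ <;> rw [h]
        · simp only [one_pow]
          linarith [pow_nonneg (norm_nonneg t) N]
        · linarith
  calc X * (1 + ‖t‖) ^ N ≤ X * (2 ^ N * (1 + ‖t‖ ^ N)) := by gcongr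
    _ = 2 ^ N * (X + ‖t‖ ^ N * X) := by ring
    _ ≤ 2 ^ N * (A + A') := by gcongr

end Weights

section FourierBump

open Real FourierTransform Module

variable {E : Type*} [NormedAddCommGroup E] [InnerProductSpace ℝ E] [FiniteDimensional ℝ E]
  [MeasurableSpace E] [BorelSpace E]

theorem contDiff_fourier_of_hasCompactSupport {b : E → ℂ} (hb : Continuous b)
    (hc : HasCompactSupport b) : ContDiff ℝ (⊤ : ℕ∞) (𝓕 b) :=
  Real.contDiff_fourier fun n _ => Continuous.integrable_of_hasCompactSupport
    (by fun_prop) hc.norm.mul_left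

/-- The derivatives of the Fourier transform of a test function grow geometrically, with an
arbitrary polynomial decay. -/
theorem exists_norm_iteratedFDeriv_fourier_le {b : E → ℂ} (hb : ContDiff ℝ (⊤ : ℕ∞) b)
    (hc : HasCompactSupport b) (N : ℕ) :
    ∃ C B : ℝ, 0 ≤ C ∧ 1 ≤ B ∧ ∀ k t, ‖iteratedFDeriv ℝ k (𝓕 b) t‖ ≤ C * B ^ k * invOneAddNorm N t := by
  obtain ⟨ρ, hρ1, hρ⟩ : ∃ ρ : ℝ, 1 ≤ ρ ∧ ∀ v ∈ tsupport b, ‖v‖ ≤ ρ := by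
    obtain ⟨ρ, hρ⟩ := hc.isCompact.isBounded.exists_norm_le
    exact ⟨max 1 ρ, le_max_left _ _, fun v hv => (hρ v hv).trans (le_max_right _ _)⟩
  have hcont : ∀ q : ℕ, Continuous (iteratedFDeriv ℝ q b) := fun q =>
    hb.continuous_iteratedFDeriv (by exact_mod_cast le_top)
  have hint : ∀ p q : ℕ, Integrable fun v => ‖v‖ ^ p * ‖iteratedFDeriv ℝ q b v‖ := fun p q =>
    Continuous.integrable_of_hasCompactSupport ((continuous_norm.pow p).mul (hcont q).norm)
      (hc.iteratedFDeriv q).norm.mul_left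
  set I : ℝ := ∑ q ∈ Finset.range (N + 1), ∫ v, ‖iteratedFDeriv ℝ q b v‖ with hI
  have hI0 : 0 ≤ I := Finset.sum_nonneg fun q _ => integral_nonneg fun _ => norm_nonneg _
  have hterm : ∀ k p q : ℕ, p ≤ k → q ≤ N →
      ∫ v, ‖v‖ ^ p * ‖iteratedFDeriv ℝ q b v‖ ≤ ρ ^ k * I := by
    intro k p q hp hq
    have h1 : ∫ v, ‖v‖ ^ p * ‖iteratedFDeriv ℝ q b v‖ ≤
        ∫ v, ρ ^ k * ‖iteratedFDeriv ℝ q b v‖ := by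
      refine integral_mono (hint p q) (by simpa using (hint 0 q).const_mul (ρ ^ k)) fun v => ?_
      by_cases hv : v ∈ tsupport b
      · simp only
        gcongr
        exact (pow_le_pow_left₀ (norm_nonneg v) (hρ v hv) p).trans (pow_le_pow_right₀ hρ1 hp)
      · have : iteratedFDeriv ℝ q b v = 0 :=
          Function.notMem_support.1 fun h => hv (support_iteratedFDeriv_subset q h)
        simp [this]
    rw [integral_const_mul] at h1
    refine h1.trans (mul_le_mul_of_nonneg_left ?_ (by positivity))
    exact Finset.single_le_sum (f := fun q => ∫ v, ‖iteratedFDeriv ℝ q b v‖)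
      (fun q _ => integral_nonneg fun _ => norm_nonneg _) (Finset.mem_range.2 (by omega))
  have hmain : ∀ k n : ℕ, n ≤ N → ∀ t, ‖t‖ ^ n * ‖iteratedFDeriv ℝ k (𝓕 b) t‖ ≤
      2 ^ N * (N + 1) * I * (2 * π * ρ * 2 ^ (N + 1)) ^ k := by
    intro k n hn t
    have h := Real.pow_mul_norm_iteratedFDeriv_fourier_le (K := (⊤ : ℕ∞)) (N := (⊤ : ℕ∞)) hb
      (fun p q _ _ => hint p q) (k := k) (n := n) le_top le_top t
    refine h.trans ?_
    have hsum : ∑ p ∈ Finset.range (k + 1) ×ˢ Finset.range (n + 1),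
        ∫ v, ‖v‖ ^ p.1 * ‖iteratedFDeriv ℝ p.2 b v‖ ≤ ((k + 1) * (N + 1)) * (ρ ^ k * I) := by
      refine (Finset.sum_le_card_nsmul _ _ (ρ ^ k * I) fun p hp => ?_).trans ?_
      · simp only [Finset.mem_product, Finset.mem_range] at hp
        exact hterm k p.1 p.2 (by omega) (by omega)
      · rw [nsmul_eq_mul, Finset.card_product, Finset.card_range, Finset.card_range]
        push_cast
        gcongr
    have hk : (k : ℝ) + 1 ≤ 2 ^ k := by exact_mod_cast Nat.lt_two_pow_self
    -- Since `n ≤ N` is bounded, these factors are polynomial in `k` and disappear into the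
    -- geometric constant by `k + 1 ≤ 2 ^ k`.
    have hkn : (2 * (k : ℝ) + 2) ^ n * (k + 1) ≤ 2 ^ N * (2 ^ (N + 1)) ^ k := by
      calc (2 * (k : ℝ) + 2) ^ n * (k + 1) ≤ (2 * (k : ℝ) + 2) ^ N * (k + 1) := by
            gcongr
            linarith [(k.cast_nonneg : (0 : ℝ) ≤ k)]
        _ = 2 ^ N * (k + 1) ^ (N + 1) := by
            rw [show 2 * (k : ℝ) + 2 = 2 * (k + 1) by ring, mul_pow]
            ring
        _ ≤ 2 ^ N * (2 ^ k) ^ (N + 1) := by gcongr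
        _ = _ := by rw [← pow_mul, ← pow_mul, mul_comm k]
    calc (2 * π) ^ k * (2 * (k : ℝ) + 2) ^ n * ∑ p ∈ Finset.range (k + 1) ×ˢ Finset.range (n + 1),
          ∫ v, ‖v‖ ^ p.1 * ‖iteratedFDeriv ℝ p.2 b v‖
        ≤ (2 * π) ^ k * (2 * (k : ℝ) + 2) ^ n * (((k + 1) * (N + 1)) * (ρ ^ k * I)) := by gcongr
      _ = ((2 * (k : ℝ) + 2) ^ n * (k + 1)) * ((2 * π) ^ k * (N + 1) * (ρ ^ k * I)) := by ring
      _ ≤ (2 ^ N * (2 ^ (N + 1)) ^ k) * ((2 * π) ^ k * (N + 1) * (ρ ^ k * I)) := by gcongr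
      _ = _ := by
        rw [mul_pow (2 * π * ρ), mul_pow (2 * π)]
        ring
  refine ⟨2 ^ N * (2 * (2 ^ N * (N + 1) * I)), 2 * π * ρ * 2 ^ (N + 1), by positivity, ?_,
    fun k t => ?_⟩
  · have h1 : 1 ≤ 2 * π := by linarith [pi_gt_three]
    exact one_le_mul_of_one_le_of_one_le (one_le_mul_of_one_le_of_one_le h1 hρ1)
      (one_le_pow₀ one_le_two)
  · have h0 := hmain k 0 (Nat.zero_le _) t
    rw [pow_zero, one_mul] at h0
    refine (le_mul_invOneAddNorm (norm_nonneg _) h0 (hmain k N le_rfl t)).trans_eq ?_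
    ring

theorem integrable_fourier {u : E → ℂ} (hu : ContDiff ℝ (⊤ : ℕ∞) u)
    (hi : ∀ n : ℕ, Integrable (iteratedFDeriv ℝ n u)) : Integrable (𝓕 u) := by
  have hui : Integrable u := by
    refine (hi 0).norm.mono' hu.continuous.aestronglyMeasurable (.of_forall fun t => ?_)
    rw [norm_iteratedFDeriv_zero]
  have hcont : Continuous (𝓕 u) := VectorFourier.fourierIntegral_continuous
    Real.continuous_fourierChar (by exact continuous_inner) hui
  set N := finrank ℝ E + 1
  refine ((integrable_invOneAddNorm (E := E) volume).const_mul (2 ^ N *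
    ((∫ t, ‖iteratedFDeriv ℝ 0 u t‖) + ∫ t, ‖iteratedFDeriv ℝ N u t‖))).mono'
    hcont.aestronglyMeasurable (.of_forall fun k => ?_)
  have h0 := norm_fourier_mul_pow_le hu hi 0 k
  rw [pow_zero, one_mul] at h0
  refine le_mul_invOneAddNorm (norm_nonneg _) h0 (le_trans ?_ (norm_fourier_mul_pow_le hu hi N k))
  gcongr
  nlinarith [pi_gt_three, norm_nonneg k]

theorem fourier_comp_sub (b : E → ℂ) (k t : E) :
    𝓕 (fun w => b (w - k)) t = planeWave k (-t) * 𝓕 b t := by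
  rw [Real.fourier_eq', Real.fourier_eq', ← integral_const_mul,
    ← integral_sub_right_eq_self (fun w => planeWave k (-t) *
      (Complex.exp (((-2 * π * inner ℝ w t : ℝ) : ℂ) * Complex.I) • b w)) k]
  refine integral_congr_ae (.of_forall fun w => ?_)
  simp only [planeWave, smul_eq_mul]
  rw [← mul_assoc, ← Complex.exp_add]
  congr 2
  rw [inner_sub_left, inner_neg_left, real_inner_comm k t]
  push_cast
  ring

/-- A function is the sum of its wave packets with respect to a partition of unity. -/
theorem hasSum_wavePacket {ι : Type*} [Countable ι] (p : ι → E) {b : E → ℝ} (hb : Continuous b)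
    (hc : HasCompactSupport b) (hb0 : ∀ w, 0 ≤ b w) (hsum : ∀ w, HasSum (fun i => b (w - p i)) 1)
    {φ : E → ℂ} (hφ : ContDiff ℝ (⊤ : ℕ∞) φ) (hi : ∀ n : ℕ, Integrable (iteratedFDeriv ℝ n φ)) (x : E) :
    HasSum (fun i => wavePacket (𝓕 fun w => (b w : ℂ)) (p i) φ x) (φ x) := by
  set u : E → ℂ := fun t => φ (x - t) with hu
  have hus : ContDiff ℝ (⊤ : ℕ∞) u := hφ.comp (contDiff_const.sub contDiff_id)
  have hui : ∀ n : ℕ, Integrable (iteratedFDeriv ℝ n u) := fun n => by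
    refine ((hi n).comp_sub_left x).norm.mono'
      (hus.continuous_iteratedFDeriv (by exact_mod_cast le_top)).aestronglyMeasurable
      (.of_forall fun t => (norm_iteratedFDeriv_comp_const_sub φ n x t).le)
  have hui0 : Integrable u := by
    refine (hui 0).norm.mono' hus.continuous.aestronglyMeasurable (.of_forall fun t => ?_)
    rw [norm_iteratedFDeriv_zero]
  have hFi := integrable_fourier hus hui
  have hbc : ∀ k : E, Integrable fun w => (b (w - k) : ℂ) := fun k =>
    (Continuous.integrable_of_hasCompactSupport (f := fun w => (b w : ℂ)) (by fun_prop)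
      (hc.comp_left Complex.ofReal_zero)).comp_sub_right k
  -- The multiplication formula moves the Fourier transform from the shifted bump to `u`. Summing
  -- over the shifts then leaves `∫ 𝓕 u`, which is `u 0 = φ x` by inversion.
  have hW : ∀ k, wavePacket (𝓕 fun w => (b w : ℂ)) k φ x = ∫ w, 𝓕 u w * (b (w - k) : ℂ) := by
    intro k
    have h1 := VectorFourier.integral_fourierIntegral_smul_eq_flip (L := innerₗ E) (μ := volume)
      (ν := volume) Real.continuous_fourierChar continuous_inner hui0 (hbc k)
    rw [flip_innerₗ] at h1
    refine Eq.trans ?_ h1.symm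
    rw [wavePacket, ← integral_sub_left_eq_self _ volume x]
    refine integral_congr_ae (.of_forall fun t => ?_)
    have h2 := fourier_comp_sub (fun w => (b w : ℂ)) k t
    simp only [hu, smul_eq_mul, sub_sub_cancel, sub_sub_cancel_left]
    rw [← h2]
    rfl
  have hinv : ∫ w, 𝓕 u w = φ x := by
    have h1 := hui0.fourierInv_fourier_eq hFi hus.continuous.continuousAt (v := (0 : E))
    rw [Real.fourierInv_eq'] at h1
    simpa [hu] using h1
  simp only [hW]
  rw [← hinv]
  refine hasSum_integral_of_dominated_convergence (fun i w => ‖𝓕 u w‖ * b (w - p i))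
    (fun i => hFi.1.mul (hbc _).1) (fun i => .of_forall fun w => ?_)
    (.of_forall fun w => ((hsum w).mul_left _).summable) ?_ (.of_forall fun w => ?_)
  · rw [norm_mul, Complex.norm_real, Real.norm_of_nonneg (hb0 _)]
  · refine hFi.norm.congr (.of_forall fun w => ?_)
    simp only
    rw [((hsum w).mul_left _).tsum_eq, mul_one]
  · have := (Complex.hasSum_ofReal.2 (hsum w)).mul_left (𝓕 u w)
    simpa using this

end FourierBump

/-! ### The partition of unity on the integer lattice -/

section LatticePartition

variable {d : ℕ}

/-- The point of `ℝᵈ` with integer coordinates `κ`. -/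
def latticePoint (κ : Fin d → ℤ) : EuclideanSpace ℝ (Fin d) := WithLp.toLp 2 fun i => (κ i : ℝ)

/-- A smooth function on `ℝ`, supported in `[-1, 1]`, whose integer translates sum up to `1`. -/
def lineBump (x : ℝ) : ℝ := Real.smoothTransition (x + 1) - Real.smoothTransition x

theorem lineBump_nonneg (x : ℝ) : 0 ≤ lineBump x :=
  sub_nonneg.2 (Real.smoothTransition.monotone (by linarith))

theorem abs_lt_of_lineBump_ne_zero {x : ℝ} (h : lineBump x ≠ 0) : |x| < 1 := by
  rw [abs_lt]
  by_contra! hx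
  refine h ?_
  by_cases h1 : -1 < x
  · have := hx h1
    rw [lineBump, Real.smoothTransition.one_of_one_le this,
      Real.smoothTransition.one_of_one_le (by linarith), sub_self]
  · rw [lineBump, Real.smoothTransition.zero_of_nonpos (by linarith),
      Real.smoothTransition.zero_of_nonpos (by linarith), sub_self]

/-- The tensor product of copies of `lineBump`. -/
def cubeBump (w : EuclideanSpace ℝ (Fin d)) : ℝ := ∏ j, lineBump (w j)

theorem contDiff_cubeBump : ContDiff ℝ (⊤ : ℕ∞) (cubeBump : EuclideanSpace ℝ (Fin d) → ℝ) := by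
  have h : ContDiff ℝ (⊤ : ℕ∞) lineBump :=
    (Real.smoothTransition.contDiff.comp (contDiff_id.add contDiff_const)).sub
      Real.smoothTransition.contDiff
  exact contDiff_prod fun j _ => h.comp (by fun_prop)

theorem cubeBump_nonneg (w : EuclideanSpace ℝ (Fin d)) : 0 ≤ cubeBump w :=
  Finset.prod_nonneg fun _ _ => lineBump_nonneg _

theorem hasCompactSupport_cubeBump :
    HasCompactSupport (cubeBump : EuclideanSpace ℝ (Fin d) → ℝ) := by
  refine HasCompactSupport.of_support_subset_isCompact
    (isCompact_closedBall (0 : EuclideanSpace ℝ (Fin d)) d) fun w hw => ?_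
  rw [mem_closedBall_zero_iff]
  have h : ∀ j, |w j| < 1 := fun j =>
    abs_lt_of_lineBump_ne_zero (Finset.prod_ne_zero_iff.1 hw j (Finset.mem_univ j))
  rw [EuclideanSpace.norm_eq]
  refine Real.sqrt_le_iff.2 ⟨by positivity, ?_⟩
  calc ∑ j, ‖w j‖ ^ 2 ≤ ∑ _j : Fin d, (1 : ℝ) := Finset.sum_le_sum fun j _ =>
        pow_le_one₀ (norm_nonneg _) (h j).le
    _ = d := by simp
    _ ≤ (d : ℝ) ^ 2 := by exact_mod_cast Nat.le_self_pow two_ne_zero d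

/-- In each coordinate only the translates by `⌊w j⌋` and `⌊w j⌋ + 1` can contribute, and their sum
telescopes to `1`. Expanding the product of these sums gives the lattice sum. -/
theorem hasSum_cubeBump_sub (w : EuclideanSpace ℝ (Fin d)) :
    HasSum (fun κ : Fin d → ℤ => cubeBump (w - latticePoint κ)) 1 := by
  set t : Fin d → Finset ℤ := fun j => {⌊w j⌋, ⌊w j⌋ + 1}
  have h1 : ∑ κ ∈ Fintype.piFinset t, cubeBump (w - latticePoint κ) = 1 := by
    have h2 := Finset.prod_univ_sum t fun j k => lineBump (w j - k)
    simp only [cubeBump, latticePoint, PiLp.sub_apply]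
    rw [← h2]
    refine Finset.prod_eq_one fun j _ => ?_
    rw [Finset.sum_pair (by simp), lineBump, lineBump]
    push_cast
    rw [Real.smoothTransition.one_of_one_le (by linarith [Int.floor_le (w j)]),
      Real.smoothTransition.zero_of_nonpos (x := w j - (⌊w j⌋ + 1))
        (by linarith [Int.lt_floor_add_one (w j)])]
    rw [show w j - (⌊w j⌋ + 1) + 1 = w j - ⌊w j⌋ by ring]
    ring
  rw [← h1]
  refine hasSum_sum_of_ne_finset_zero fun κ hκ => ?_
  by_contra hne
  refine hκ (Fintype.mem_piFinset.2 fun j => ?_)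
  have h3 := abs_lt.1 (abs_lt_of_lineBump_ne_zero (Finset.prod_ne_zero_iff.1 hne j (Finset.mem_univ j)))
  simp only [latticePoint, PiLp.sub_apply] at h3
  have h4 : ⌊w j⌋ ≤ κ j := by
    have : (⌊w j⌋ : ℝ) < κ j + 1 := by linarith [Int.floor_le (w j)]
    exact Int.lt_add_one_iff.1 (by exact_mod_cast this)
  have h5 : κ j ≤ ⌊w j⌋ + 1 := by
    have : (κ j : ℝ) < ⌊w j⌋ + 1 + 1 := by linarith [Int.lt_floor_add_one (w j)]
    exact Int.lt_add_one_iff.1 (by exact_mod_cast this)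
  simp only [t, Finset.mem_insert, Finset.mem_singleton]
  omega

theorem summable_invOneAddNorm_latticePoint :
    Summable fun κ : Fin d → ℤ => invOneAddNorm (d + 1) (latticePoint κ) := by
  let b := (EuclideanSpace.basisFun (Fin d) ℝ).toBasis
  let L := Submodule.span ℤ (Set.range b)
  have hL := ZLattice.summable_norm_pow_inv L (d + 1) (by
    rw [ZLattice.rank ℝ L]
    simp)
  have hmem : ∀ κ : Fin d → ℤ, latticePoint κ ∈ L := fun κ => by
    exact (Module.Basis.mem_span_iff_repr_mem ℤ b _).2 fun i => ⟨κ i, by simp [b, latticePoint]⟩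
  have hinj : Function.Injective fun κ : Fin d → ℤ => (⟨latticePoint κ, hmem κ⟩ : L) := by
    intro κ κ' h
    funext i
    have := congrArg (fun z : L => (z : EuclideanSpace ℝ (Fin d)) i) h
    simpa [latticePoint] using this
  refine Summable.of_norm_bounded_eventually (hL.comp_injective hinj) ?_
  -- The origin is excluded: there the comparison term is `0⁻¹ ^ (d + 1) = 0`.
  rw [Filter.eventually_cofinite]
  refine (Set.finite_singleton (0 : Fin d → ℤ)).subset fun κ hκ => ?_
  by_contra hne
  refine hκ ?_
  have h0 : latticePoint κ ≠ 0 := fun h => hne <| by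
    funext i
    have := congrArg (fun z : EuclideanSpace ℝ (Fin d) => z i) h
    simpa [latticePoint] using this
  have h1 : 0 < ‖latticePoint κ‖ := norm_pos_iff.2 h0
  rw [Real.norm_of_nonneg (invOneAddNorm_pos _ _).le, invOneAddNorm]
  simp only [Function.comp_apply, inv_pow]
  change _ ≤ (‖latticePoint κ‖ ^ (d + 1))⁻¹
  gcongr
  linarith

end LatticePartition

end

/-! ### Convergence of series in a step -/

noncomputable section

open FourierTransform

theorem integral_norm_le_tsum {X ι : Type*} [MeasurableSpace X] {μ : Measure X} [Countable ι]
    {F : ι → X → ℂ} {g : X → ℂ} (hF : ∀ i, Integrable (F i) μ) (hg : Integrable g μ)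
    (hs : Summable fun i => ∫ x, ‖F i x‖ ∂μ) (h : ∀ x, HasSum (fun i => F i x) (g x)) :
    ∫ x, ‖g x‖ ∂μ ≤ ∑' i, ∫ x, ‖F i x‖ ∂μ := by
  have hn : ∀ i, 0 ≤ ∫ x, ‖F i x‖ ∂μ := fun i => integral_nonneg fun _ => norm_nonneg _
  rw [← ENNReal.ofReal_le_ofReal_iff (tsum_nonneg hn), ENNReal.ofReal_tsum_of_nonneg hn hs,
    ofReal_integral_norm_eq_lintegral_enorm hg]
  simp only [fun i => ofReal_integral_norm_eq_lintegral_enorm (hF i)]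
  rw [← lintegral_tsum fun i => (hF i).1.enorm]
  refine lintegral_mono fun x => ?_
  rw [← (h x).tsum_eq]
  exact enorm_tsum_le_tsum_enorm

namespace DL1Step

variable {ω : WeightFunction} {d : ℕ} {n : ℕ+}

theorem weightedL1_le_norm (φ : DL1Step ω d n) (α : Fin d → ℕ) : weightedL1 ω n α φ.1 ≤ ‖φ‖ :=
  le_ciSup φ.2.2.2 α

theorem norm_le {φ : DL1Step ω d n} {A : ℝ} (h : ∀ α, weightedL1 ω n α φ.1 ≤ A) : ‖φ‖ ≤ A :=
  ciSup_le h

/-- The partial derivative as a linear map on `DL1Step`. -/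
def mderivₗ (ω : WeightFunction) (n : ℕ+) (α : Fin d → ℕ) :
    DL1Step ω d n →ₗ[ℂ] (EuclideanSpace ℝ (Fin d) → ℂ) where
  toFun φ := mderiv α φ.1
  map_add' φ θ := mderiv_add φ.2.1 θ.2.1 α
  map_smul' c φ := mderiv_smul φ.2.1 c α

/-- A series whose norms are summable and whose derivatives converge pointwise converges in
`DL1Step`. -/
theorem hasSum_of_hasSum_mderiv {ι : Type*} [Countable ι] {T : ι → DL1Step ω d n}
    {φ : DL1Step ω d n} (hs : Summable fun i => ‖T i‖)
    (hp : ∀ α x, HasSum (fun i => mderiv α (T i).1 x) (mderiv α φ.1 x)) : HasSum T φ := by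
  rw [HasSum, SummationFilter.unconditional_filter, tendsto_iff_norm_sub_tendsto_zero]
  refine squeeze_zero (fun _ => norm_nonneg _) (fun S => ?_)
    (tendsto_tsum_compl_atTop_zero fun i => ‖T i‖)
  rw [norm_sub_rev]
  have hsS : Summable fun i : {i // i ∉ S} => ‖T i‖ := hs.subtype _
  refine norm_le fun α => ?_
  -- Pointwise convergence identifies the remainder as the tail of the series; its norm is then at
  -- most the tail of the norms. No completeness of the step is needed.
  have hx : ∀ x, HasSum (fun i : {i // i ∉ S} => mderiv α (T i).1 x)
      (mderiv α (φ - ∑ i ∈ S, T i).1 x) := by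
    intro x
    have h1 : mderiv α (φ - ∑ i ∈ S, T i).1 x = mderiv α φ.1 x - ∑ i ∈ S, mderiv α (T i).1 x := by
      have h2 := congrFun (map_sub (mderivₗ ω n α) φ (∑ i ∈ S, T i)) x
      rw [map_sum, Pi.sub_apply, Finset.sum_apply] at h2
      exact h2
    rw [h1]
    exact (Finset.hasSum_compl_iff (f := fun i => mderiv α (T i).1 x) S).2 (by simpa using hp α x)
  set c := Real.exp (-(1 / (n : ℝ) * ω.psiStar (n * (∑ i, α i : ℕ)))) with hc
  have hc0 : 0 < c := Real.exp_pos _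
  have hle : ∀ i, (∫ x, ‖mderiv α (T i).1 x‖) * c ≤ ‖T i‖ := fun i => weightedL1_le_norm (T i) α
  have hint : Summable fun i : {i // i ∉ S} => ∫ x, ‖mderiv α (T i).1 x‖ := by
    refine Summable.of_nonneg_of_le (fun i => integral_nonneg fun _ => norm_nonneg _) (fun i => ?_)
      (hsS.mul_right c⁻¹)
    rw [← div_eq_mul_inv, le_div_iff₀ hc0]
    exact hle i
  calc weightedL1 ω n α (φ - ∑ i ∈ S, T i).1
      ≤ (∑' i : {i // i ∉ S}, ∫ x, ‖mderiv α (T i).1 x‖) * c :=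
        mul_le_mul_of_nonneg_right (integral_norm_le_tsum (fun i => (T i).2.2.1 α)
          ((φ - ∑ i ∈ S, T i).2.2.1 α) hint hx) hc0.le
    _ = ∑' i : {i // i ∉ S}, (∫ x, ‖mderiv α (T i).1 x‖) * c := tsum_mul_right.symm
    _ ≤ ∑' i : {i // i ∉ S}, ‖T i‖ := (hint.mul_right c).tsum_le_tsum (fun i => hle i) hsS

end DL1Step

end

/-! ### Decay of wave packets in frequency -/

noncomputable section

section Estimates

open Real FourierTransform

variable {d : ℕ}

/-- The window of the wave packets, a band limited function. -/
def cubeWindow (d : ℕ) : EuclideanSpace ℝ (Fin d) → ℂ := 𝓕 fun w => (cubeBump w : ℂ)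

theorem contDiff_ofReal_cubeBump :
    ContDiff ℝ (⊤ : ℕ∞) fun w : EuclideanSpace ℝ (Fin d) => (cubeBump w : ℂ) :=
  Complex.ofRealCLM.contDiff.comp contDiff_cubeBump

theorem hasCompactSupport_ofReal_cubeBump :
    HasCompactSupport fun w : EuclideanSpace ℝ (Fin d) => (cubeBump w : ℂ) :=
  hasCompactSupport_cubeBump.comp_left Complex.ofReal_zero

theorem contDiff_cubeWindow (d : ℕ) : ContDiff ℝ (⊤ : ℕ∞) (cubeWindow d) :=
  contDiff_fourier_of_hasCompactSupport contDiff_ofReal_cubeBump.continuous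
    hasCompactSupport_ofReal_cubeBump

theorem exists_norm_iteratedFDeriv_cubeWindow_le (d : ℕ) :
    ∃ C B : ℝ, 0 ≤ C ∧ 1 ≤ B ∧ ∀ k t, ‖iteratedFDeriv ℝ k (cubeWindow d) t‖ ≤
      C * B ^ k * invOneAddNorm (d + 1) t :=
  exists_norm_iteratedFDeriv_fourier_le contDiff_ofReal_cubeBump
    hasCompactSupport_ofReal_cubeBump (d + 1)

/-- Monotonicity of `ψ*` replaces every order `j ≤ m` by `m`, and the binomial theorem sums `B ^ (m
- j) * d ^ j`. This is where the frequency scale `B + d` originates. -/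
theorem sum_integral_norm_iteratedFDeriv_le {σ : WeightFunction} {n : ℕ+}
    {φ : EuclideanSpace ℝ (Fin d) → ℂ} (hφ : φ ∈ DL1StepSubmodule σ d n) {A : ℝ}
    (hA : ∀ α, weightedL1 σ n α φ ≤ A) {B : ℝ} (hB : 0 ≤ B) (m : ℕ) :
    ∑ j ∈ Finset.range (m + 1), (m.choose j : ℝ) * B ^ (m - j) * ∫ t, ‖iteratedFDeriv ℝ j φ t‖ ≤
      A * (B + d) ^ m * exp (1 / (n : ℝ) * σ.psiStar (n * m)) := by
  have hn : (0 : ℝ) < n := by exact_mod_cast n.pos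
  have hA0 : 0 ≤ A := (weightedL1_nonneg σ n 0 φ).trans (hA 0)
  have h : ∀ j ≤ m, ∫ t, ‖iteratedFDeriv ℝ j φ t‖ ≤
      d ^ j * (A * exp (1 / (n : ℝ) * σ.psiStar (n * m))) := by
    intro j hj
    refine integral_norm_iteratedFDeriv_le hφ.1 hφ.2.1 j fun α hα => ?_
    have h1 := hA α
    rw [weightedL1, hα, exp_neg, ← div_eq_mul_inv, div_le_iff₀ (exp_pos _)] at h1
    refine h1.trans ?_
    gcongr
    exact σ.psiStar_mono (by gcongr)
  calc ∑ j ∈ Finset.range (m + 1), (m.choose j : ℝ) * B ^ (m - j) *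
        ∫ t, ‖iteratedFDeriv ℝ j φ t‖
      ≤ ∑ j ∈ Finset.range (m + 1), (m.choose j : ℝ) * B ^ (m - j) *
          (d ^ j * (A * exp (1 / (n : ℝ) * σ.psiStar (n * m)))) := by
        refine Finset.sum_le_sum fun j hj => ?_
        gcongr
        exact h j (Nat.lt_succ_iff.1 (Finset.mem_range.1 hj))
    _ = _ := by
        rw [add_comm B, add_pow, Finset.mul_sum, Finset.sum_mul]
        refine Finset.sum_congr rfl fun j _ => ?_
        ring

/-- The wave packets of frequency `k` decay like `exp(-σ(c|k|)/n)`, both in `L¹` and in `L^∞`. -/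
theorem exists_wavePacket_le (d : ℕ) : ∃ C B : ℝ, 0 ≤ C ∧ 1 ≤ B ∧
    ∀ (σ : WeightFunction) (n : ℕ+) (φ : EuclideanSpace ℝ (Fin d) → ℂ),
      φ ∈ DL1StepSubmodule σ d n → ∀ A : ℝ, (∀ α, weightedL1 σ n α φ ≤ A) →
      ∀ (k : EuclideanSpace ℝ (Fin d)) (l : ℕ),
        Integrable (iteratedFDeriv ℝ l (wavePacket (cubeWindow d) k φ)) ∧
        ∫ x, ‖iteratedFDeriv ℝ l (wavePacket (cubeWindow d) k φ) x‖ ≤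
          C * A * (2 * π * ‖k‖ + B) ^ l * (max 1 (2 * π * ‖k‖ / (B + d)) *
            exp (-(1 / (n : ℝ) * σ (2 * π * ‖k‖ / (B + d))))) ∧
        ∀ x, ‖iteratedFDeriv ℝ l (wavePacket (cubeWindow d) k φ) x‖ ≤
          C * A * (2 * π * ‖k‖ + B) ^ l * (max 1 (2 * π * ‖k‖ / (B + d)) *
            exp (-(1 / (n : ℝ) * σ (2 * π * ‖k‖ / (B + d))))) := by
  obtain ⟨C, B, hC, hB, hG⟩ := exists_norm_iteratedFDeriv_cubeWindow_le d
  set v : EuclideanSpace ℝ (Fin d) → ℝ := invOneAddNorm (d + 1) with hvdef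
  have hv : Continuous v := continuous_invOneAddNorm _
  have hv0 : ∀ t, 0 ≤ v t := fun t => (invOneAddNorm_pos _ t).le
  have hv1 : ∀ t, v t ≤ 1 := invOneAddNorm_le_one _
  have hvi : Integrable v := by
    simpa using integrable_invOneAddNorm (E := EuclideanSpace ℝ (Fin d)) volume
  have hI0 : 0 ≤ ∫ t, v t := integral_nonneg hv0
  have hB0 : 0 ≤ B := zero_le_one.trans hB
  refine ⟨C * (1 + ∫ t, v t), B, by positivity, hB, fun σ n φ hφ A hA k l => ?_⟩
  have hA0 : 0 ≤ A := (weightedL1_nonneg σ n 0 φ).trans (hA 0)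
  have hi : ∀ j, Integrable (iteratedFDeriv ℝ j φ) := integrable_iteratedFDeriv hφ.1 hφ.2.1
  set T := wavePacket (cubeWindow d) k φ
  have hφi : Integrable φ := by simpa [mderiv_zero] using hφ.2.1 0
  have hT : ContDiff ℝ (⊤ : ℕ∞) T := contDiff_wavePacket (contDiff_cubeWindow d)
    (fun j => ⟨C * B ^ j, fun t => (hG j t).trans (mul_le_of_le_one_right (by positivity) (hv1 t))⟩)
    hφi k
  have hpt : ∀ (m : ℕ) (x : EuclideanSpace ℝ (Fin d)), (2 * π * ‖k‖) ^ m * ‖iteratedFDeriv ℝ l T x‖ ≤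
      C * (2 * π * ‖k‖ + B) ^ l * binomialMajorant v B φ m x := fun m x =>
    norm_iteratedFDeriv_wavePacket_le (contDiff_cubeWindow d) hv hv0 hv1 hC hB0 hG hφ.1 hi k x m l
  have hmi : ∀ m, Integrable (binomialMajorant v B φ m) := fun m => integrable_binomialMajorant hvi hi m
  have hTi : Integrable (iteratedFDeriv ℝ l T) := by
    refine ((hmi 0).const_mul (C * (2 * π * ‖k‖ + B) ^ l)).mono'
      (hT.continuous_iteratedFDeriv (by exact_mod_cast le_top)).aestronglyMeasurable
      (.of_forall fun x => ?_)
    simpa using hpt 0 x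
  have hS := fun m => sum_integral_norm_iteratedFDeriv_le hφ hA hB0 m
  set P := C * (2 * π * ‖k‖ + B) ^ l with hP
  have hP0 : 0 ≤ P := by positivity
  have hBd : 0 < B + d := by positivity
  -- Here `X` stands for either the `L¹` norm or a pointwise value. In `1 + ∫ v`, the integral
  -- serves the former (Fubini for a convolution) and the `1` the latter (`v ≤ 1`).
  have key : ∀ X : ℝ, (∀ m : ℕ, (2 * π * ‖k‖) ^ m * X ≤ P * ((1 + ∫ t, v t) *
      ∑ j ∈ Finset.range (m + 1), (m.choose j : ℝ) * B ^ (m - j) *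
        ∫ t, ‖iteratedFDeriv ℝ j φ t‖)) →
      X ≤ C * (1 + ∫ t, v t) * A * (2 * π * ‖k‖ + B) ^ l * (max 1 (2 * π * ‖k‖ / (B + d)) *
            exp (-(1 / (n : ℝ) * σ (2 * π * ‖k‖ / (B + d))))) := by
    intro X hX
    refine (σ.le_exp_of_forall_pow n (r := 2 * π * ‖k‖ / (B + d))
      (A := P * (1 + ∫ t, v t) * A) (by positivity) (by positivity) fun m => ?_).trans_eq ?_
    · rw [div_pow, ← mul_div_assoc, div_le_iff₀ (by positivity), mul_comm X]
      refine (hX m).trans ((mul_le_mul_of_nonneg_left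
        (mul_le_mul_of_nonneg_left (hS m) (by positivity)) hP0).trans_eq ?_)
      ring
    · rw [hP]
      ring
  have hsum0 : ∀ m : ℕ, 0 ≤ ∑ j ∈ Finset.range (m + 1), (m.choose j : ℝ) * B ^ (m - j) *
      ∫ t, ‖iteratedFDeriv ℝ j φ t‖ := fun m => Finset.sum_nonneg fun j _ =>
    mul_nonneg (by positivity) (integral_nonneg fun _ => norm_nonneg _)
  refine ⟨hTi, key _ fun m => ?_, fun x => key _ fun m => ?_⟩
  · rw [← integral_const_mul]
    refine (integral_mono (hTi.norm.const_mul _) ((hmi m).const_mul _) (hpt m)).trans ?_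
    rw [integral_const_mul, integral_binomialMajorant hvi hi]
    gcongr
    linarith
  · refine (hpt m x).trans ?_
    refine mul_le_mul_of_nonneg_left ((binomialMajorant_le hv hv0 hv1 hB0 hi m x).trans ?_) hP0
    exact le_mul_of_one_le_left (hsum0 m) (by linarith)

/-- The frequency factors of `exists_wavePacket_le` are summable over the lattice. -/
theorem exists_freq_le_invOneAddNorm (d : ℕ) {B : ℝ} (hB : 1 ≤ B) (σ : WeightFunction) (n : ℕ+)
    (l : ℕ) : ∃ C : ℝ, 0 ≤ C ∧ ∀ k : EuclideanSpace ℝ (Fin d),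
      (2 * π * ‖k‖ + B) ^ l * (max 1 (2 * π * ‖k‖ / (B + d)) *
        exp (-(1 / (n : ℝ) * σ (2 * π * ‖k‖ / (B + d))))) ≤ C * invOneAddNorm (d + 1) k := by
  -- The exponent spends `l` on the power, `1` on `max 1 r` and `d + 1` on summability over the
  -- lattice.
  obtain ⟨C, hC⟩ := σ.exists_exp_neg_le n (l + 1 + (d + 1))
  have hBd : 1 ≤ B + d := by linarith [(d.cast_nonneg : (0 : ℝ) ≤ d)]
  have hC0 : 0 ≤ C := by
    have h := (exp_pos _).le.trans (hC 0 le_rfl)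
    simpa using h
  refine ⟨(B + d) ^ l * C * (B + d) ^ (d + 1), by positivity, fun k => ?_⟩
  set r := 2 * π * ‖k‖ / (B + d) with hr
  have hr0 : 0 ≤ r := by positivity
  have hrk : 2 * π * ‖k‖ = (B + d) * r := by
    rw [hr]
    field_simp
  have h1 : 2 * π * ‖k‖ + B ≤ (B + d) * (1 + r) := by
    rw [hrk]
    linarith [(d.cast_nonneg : (0 : ℝ) ≤ d)]
  have h2 : max 1 r ≤ 1 + r := max_le (by linarith) (by linarith)
  have h3 : 1 + ‖k‖ ≤ (B + d) * (1 + r) := by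
    nlinarith [pi_gt_three, norm_nonneg k]
  calc (2 * π * ‖k‖ + B) ^ l * (max 1 r * exp (-(1 / (n : ℝ) * σ r)))
      ≤ ((B + d) * (1 + r)) ^ l * ((1 + r) * (C * ((1 + r) ^ (l + 1 + (d + 1)))⁻¹)) := by
        gcongr
        exact hC r hr0
    _ = (B + d) ^ l * C * ((1 + r) ^ (d + 1))⁻¹ := by
        rw [mul_pow, pow_add (1 + r) (l + 1), pow_succ (1 + r) l]
        field_simp
    _ ≤ (B + d) ^ l * C * ((B + d) ^ (d + 1) * ((1 + ‖k‖) ^ (d + 1))⁻¹) := by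
        gcongr
        rw [← div_eq_mul_inv, le_div_iff₀ (by positivity), inv_mul_le_iff₀ (by positivity), mul_comm,
          ← mul_pow]
        gcongr
    _ = _ := by
        rw [invOneAddNorm]
        ring

end Estimates

end

/-! ### Wave packet operators and the packet expansion -/

noncomputable section

section Packets

open Real

variable {d : ℕ}

theorem wavePacket_add_smul {G : EuclideanSpace ℝ (Fin d) → ℂ} (hG : Continuous G) {C : ℝ}
    (hC : ∀ t, ‖G t‖ ≤ C) (k : EuclideanSpace ℝ (Fin d)) {φ θ : EuclideanSpace ℝ (Fin d) → ℂ}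
    (hφ : Integrable φ) (hθ : Integrable θ) (c : ℂ) :
    wavePacket G k (φ + c • θ) = wavePacket G k φ + c • wavePacket G k θ := by
  funext x
  have hH : Continuous fun t => planeWave k (-t) * G t :=
    (((contDiff_planeWave k (n := 0)).continuous).comp continuous_neg).mul hG
  have h := fun {ψ : EuclideanSpace ℝ (Fin d) → ℂ} (hψ : Integrable ψ) =>
    integrable_smul_comp_sub hψ hH (C := C)
      (fun t => by rw [norm_mul, norm_planeWave, one_mul]; exact hC t) x
  simp only [neg_sub, smul_eq_mul] at h
  simp only [wavePacket, Pi.add_apply, Pi.smul_apply, smul_eq_mul, add_mul, mul_assoc]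
  rw [integral_add (h hφ) ((h hθ).const_mul c), integral_const_mul]

theorem integrable_of_mem_DL1Submodule {σ : WeightFunction} {φ : EuclideanSpace ℝ (Fin d) → ℂ}
    (hφ : φ ∈ DL1Submodule σ d) : Integrable φ := by
  obtain ⟨n, hn⟩ := hφ
  simpa [mderiv_zero] using hn.2.1 0

theorem exists_norm_cubeWindow_le (d : ℕ) : ∃ C, ∀ t, ‖cubeWindow d t‖ ≤ C := by
  obtain ⟨C, B, hC, -, h⟩ := exists_norm_iteratedFDeriv_cubeWindow_le d
  refine ⟨C, fun t => ?_⟩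
  have h0 := h 0 t
  rw [norm_iteratedFDeriv_zero, pow_zero, mul_one] at h0
  exact h0.trans (mul_le_of_le_one_right hC (invOneAddNorm_le_one _ t))

theorem contDiff_wavePacket_cubeWindow {φ : EuclideanSpace ℝ (Fin d) → ℂ} (hφ : Integrable φ)
    (k : EuclideanSpace ℝ (Fin d)) :
    ContDiff ℝ (⊤ : ℕ∞) (wavePacket (cubeWindow d) k φ) := by
  obtain ⟨C, B, hC, hB, h⟩ := exists_norm_iteratedFDeriv_cubeWindow_le d
  exact contDiff_wavePacket (contDiff_cubeWindow d) (fun j => ⟨C * B ^ j, fun t =>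
    (h j t).trans (mul_le_of_le_one_right (by positivity) (invOneAddNorm_le_one _ t))⟩) hφ k

/-- Wave packets of elements of `𝓓_{L¹,σ,m}` belong to all `𝓓_{L¹,ω,n}`. -/
theorem exists_weightedL1_wavePacket_le (d : ℕ) : ∃ C B : ℝ, 0 ≤ C ∧ 1 ≤ B ∧
    ∀ (σ : WeightFunction) (m : ℕ+) (φ : EuclideanSpace ℝ (Fin d) → ℂ),
      φ ∈ DL1StepSubmodule σ d m → ∀ A : ℝ, (∀ α, weightedL1 σ m α φ ≤ A) →
      ∀ k : EuclideanSpace ℝ (Fin d),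
        (∀ l x, ‖iteratedFDeriv ℝ l (wavePacket (cubeWindow d) k φ) x‖ ≤
          C * A * (2 * π * ‖k‖ + B) ^ l * (max 1 (2 * π * ‖k‖ / (B + d)) *
            exp (-(1 / (m : ℝ) * σ (2 * π * ‖k‖ / (B + d)))))) ∧
        (∀ α, Integrable (mderiv α (wavePacket (cubeWindow d) k φ))) ∧
        ∀ (ω : WeightFunction) (n : ℕ+) (α : Fin d → ℕ),
          weightedL1 ω n α (wavePacket (cubeWindow d) k φ) ≤
            C * A * (max 1 (2 * π * ‖k‖ / (B + d)) *
            exp (-(1 / (m : ℝ) * σ (2 * π * ‖k‖ / (B + d))))) *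
            exp (1 / (n : ℝ) * ω (2 * π * ‖k‖ + B)) := by
  obtain ⟨C, B, hC, hB, h⟩ := exists_wavePacket_le d
  refine ⟨C, B, hC, hB, fun σ m φ hφ A hA k => ⟨fun l => (h σ m φ hφ A hA k l).2.2, ?_⟩⟩
  have hA0 : 0 ≤ A := (weightedL1_nonneg σ m 0 φ).trans (hA 0)
  have hT : ContDiff ℝ (⊤ : ℕ∞) (wavePacket (cubeWindow d) k φ) :=
    contDiff_wavePacket_cubeWindow (integrable_of_mem_DL1Submodule ⟨m, hφ⟩) k
  have hi : ∀ α, Integrable (mderiv α (wavePacket (cubeWindow d) k φ)) := fun α =>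
    (h σ m φ hφ A hA k (∑ i, α i)).1.norm.mono' (continuous_mderiv hT α).aestronglyMeasurable
      (.of_forall fun x => norm_mderiv_le α _ x)
  refine ⟨hi, fun ω n α => ?_⟩
  obtain ⟨h1, h2, -⟩ := h σ m φ hφ A hA k (∑ i, α i)
  have h3 := (integral_mono (hi α).norm h1.norm fun x => norm_mderiv_le α _ x).trans h2
  have hR : 1 ≤ 2 * π * ‖k‖ + B := by
    have : 0 ≤ 2 * π * ‖k‖ := by positivity
    linarith
  have h4 := ω.pow_mul_exp_psiStar_le n hR (∑ i, α i)
  have hBd : 0 < B + d := by positivity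
  rw [weightedL1]
  refine (mul_le_mul_of_nonneg_right h3 (exp_pos _).le).trans ?_
  set F := max 1 (2 * π * ‖k‖ / (B + d)) * exp (-(1 / (m : ℝ) * σ (2 * π * ‖k‖ / (B + d))))
  have hF : 0 ≤ F := by positivity
  calc _ = C * A * F * ((2 * π * ‖k‖ + B) ^ (∑ i, α i) *
        exp (-(1 / (n : ℝ) * ω.psiStar (n * (∑ i, α i : ℕ))))) := by ring
    _ ≤ _ := mul_le_mul_of_nonneg_left h4 (by positivity)

theorem wavePacket_mem {σ : WeightFunction} {φ : EuclideanSpace ℝ (Fin d) → ℂ}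
    (hφ : φ ∈ DL1Submodule σ d) (k : EuclideanSpace ℝ (Fin d)) (ω : WeightFunction) (n : ℕ+) :
    wavePacket (cubeWindow d) k φ ∈ DL1StepSubmodule ω d n := by
  obtain ⟨C, B, -, -, h⟩ := exists_weightedL1_wavePacket_le d
  have hi := integrable_of_mem_DL1Submodule hφ
  obtain ⟨m, hm⟩ := hφ
  obtain ⟨A, hA⟩ := hm.2.2
  obtain ⟨-, h1, h2⟩ := h σ m φ hm A (fun α => hA ⟨α, rfl⟩) k
  exact ⟨contDiff_wavePacket_cubeWindow hi k, h1, _, by rintro _ ⟨α, rfl⟩; exact h2 ω n α⟩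

/-- The wave packet operator `𝓓_{L¹,{σ}} → 𝓓_{L¹,ω,n}`. -/
def packetStep (σ ω : WeightFunction) (n : ℕ+) (k : EuclideanSpace ℝ (Fin d)) :
    DL1 σ d →ₗ[ℂ] DL1Step ω d n where
  toFun φ := ⟨wavePacket (cubeWindow d) k φ.1, wavePacket_mem φ.2 k ω n⟩
  map_add' φ θ := by
    obtain ⟨C, hC⟩ := exists_norm_cubeWindow_le d
    have h := wavePacket_add_smul (contDiff_cubeWindow d).continuous hC k
      (integrable_of_mem_DL1Submodule φ.2) (integrable_of_mem_DL1Submodule θ.2) 1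
    rw [one_smul, one_smul] at h
    exact Subtype.ext h
  map_smul' c φ := by
    obtain ⟨C, hC⟩ := exists_norm_cubeWindow_le d
    have h := wavePacket_add_smul (contDiff_cubeWindow d).continuous hC k
      (integrable_zero _ ℂ volume) (integrable_of_mem_DL1Submodule φ.2) c
    have h0 : wavePacket (cubeWindow d) k 0 = 0 := by
      funext x
      simp [wavePacket]
    rw [h0, zero_add, zero_add] at h
    exact Subtype.ext h

/-- The packet does not depend on the step, so the step may later be chosen separately for each
frequency. -/
theorem ofStep_packetStep (σ ω : WeightFunction) (n m : ℕ+) (k : EuclideanSpace ℝ (Fin d))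
    (φ : DL1 σ d) :
    DL1.ofStep ω d n (packetStep σ ω n k φ) = DL1.ofStep ω d m (packetStep σ ω m k φ) := rfl

theorem exists_norm_packetStep_le (d : ℕ) : ∃ C B : ℝ, 0 ≤ C ∧ 1 ≤ B ∧
    ∀ (σ ω : WeightFunction) (m n : ℕ+) (k : EuclideanSpace ℝ (Fin d)) (φ : DL1Step σ d m),
      ‖packetStep σ ω n k (DL1.ofStep σ d m φ)‖ ≤
        C * ‖φ‖ * (max 1 (2 * π * ‖k‖ / (B + d)) *
          exp (-(1 / (m : ℝ) * σ (2 * π * ‖k‖ / (B + d))))) *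
          exp (1 / (n : ℝ) * ω (2 * π * ‖k‖ + B)) := by
  obtain ⟨C, B, hC, hB, h⟩ := exists_weightedL1_wavePacket_le d
  exact ⟨C, B, hC, hB, fun σ ω m n k φ => DL1Step.norm_le fun α =>
    (h σ m φ.1 φ.2 ‖φ‖ (DL1Step.weightedL1_le_norm φ) k).2.2 ω n α⟩

/-- The uniform bounds on derivatives of the packets are summable over the lattice for each order,
so the pointwise expansion may be differentiated term by term. -/
theorem hasSum_mderiv_packetStep (ω : WeightFunction) (m n : ℕ+) (φ : DL1Step ω d m)
    (α : Fin d → ℕ) (x : EuclideanSpace ℝ (Fin d)) :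
    HasSum (fun κ : Fin d → ℤ =>
      mderiv α (packetStep ω ω n (latticePoint κ) (DL1.ofStep ω d m φ)).1 x) (mderiv α φ.1 x) := by
  obtain ⟨C, B, hC, hB, h⟩ := exists_weightedL1_wavePacket_le d
  choose D hD0 hD using exists_freq_le_invOneAddNorm d hB ω m
  have hbound : ∀ (l : ℕ) (κ : Fin d → ℤ) (x : EuclideanSpace ℝ (Fin d)),
      ‖iteratedFDeriv ℝ l (wavePacket (cubeWindow d) (latticePoint κ) φ.1) x‖ ≤
        C * ‖φ‖ * D l * invOneAddNorm (d + 1) (latticePoint κ) := by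
    intro l κ x
    refine ((h ω m φ.1 φ.2 ‖φ‖ (DL1Step.weightedL1_le_norm φ) (latticePoint κ)).1 l x).trans ?_
    rw [mul_assoc (C * ‖φ‖), mul_assoc (C * ‖φ‖)]
    exact mul_le_mul_of_nonneg_left (hD l _) (by positivity)
  have hsum : ∀ l : ℕ, Summable fun κ : Fin d → ℤ =>
      C * ‖φ‖ * D l * invOneAddNorm (d + 1) (latticePoint κ) := fun l =>
    summable_invOneAddNorm_latticePoint.mul_left _
  have hφi : Integrable φ.1 := integrable_of_mem_DL1Submodule ⟨m, φ.2⟩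
  have hφ : φ.1 = fun x => ∑' κ : Fin d → ℤ, wavePacket (cubeWindow d) (latticePoint κ) φ.1 x := by
    funext y
    exact (hasSum_wavePacket latticePoint contDiff_cubeBump.continuous hasCompactSupport_cubeBump
      cubeBump_nonneg hasSum_cubeBump_sub φ.2.1
      (integrable_iteratedFDeriv φ.2.1 φ.2.2.1) y).tsum_eq.symm
  set l := ∑ i, α i
  have hl : HasSum (fun κ : Fin d → ℤ =>
      iteratedFDeriv ℝ l (wavePacket (cubeWindow d) (latticePoint κ) φ.1) x)
      (iteratedFDeriv ℝ l φ.1 x) := by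
    have h1 := iteratedFDeriv_tsum_apply (𝕜 := ℝ) (N := (⊤ : ℕ∞))
      (f := fun (κ : Fin d → ℤ) y => wavePacket (cubeWindow d) (latticePoint κ) φ.1 y)
      (fun κ => contDiff_wavePacket_cubeWindow hφi (latticePoint κ))
      (v := fun l κ => C * ‖φ‖ * D l * invOneAddNorm (d + 1) (latticePoint κ))
      (fun l _ => hsum l) (fun l κ x _ => hbound l κ x) (k := l) le_top x
    rw [← hφ] at h1
    rw [h1]
    exact (Summable.of_norm_bounded (hsum l) fun κ => hbound l κ x).hasSum
  exact hl.mapL (ContinuousMultilinearMap.apply ℝ (fun _ => EuclideanSpace ℝ (Fin d)) ℂ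
    fun j => EuclideanSpace.single (finSigmaFinEquiv.symm j).1 1)

/-- An element of `𝓓_{L¹,ω,m}` is the sum of its wave packets in some `𝓓_{L¹,ω,n}`. -/
theorem exists_hasSum_packetStep (ω : WeightFunction) (m : ℕ+) (φ : DL1Step ω d m) :
    ∃ (n : ℕ+) (θ : DL1Step ω d n), DL1.ofStep ω d n θ = DL1.ofStep ω d m φ ∧
      HasSum (fun κ : Fin d → ℤ => packetStep ω ω n (latticePoint κ) (DL1.ofStep ω d m φ)) θ := by
  obtain ⟨C, B, hC, hB, h⟩ := exists_norm_packetStep_le d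
  have hBd : 0 < B + d := by positivity
  obtain ⟨K, hK, hωK⟩ := ω.exists_affine_le hBd.le (zero_le_one.trans hB)
  obtain ⟨M, hM⟩ := exists_nat_gt K
  have hM0 : 0 < M := by
    have : (0 : ℝ) < M := by linarith
    exact_mod_cast this
  lift M to ℕ+ using hM0
  have hm : (0 : ℝ) < m := by exact_mod_cast m.pos
  have hM' : (0 : ℝ) < M := by exact_mod_cast M.pos
  obtain ⟨D, hD0, hD⟩ := exists_freq_le_invOneAddNorm d hB ω (2 * m) 0
  have hmn : m ≤ 2 * m * M := by
    rw [← PNat.coe_le_coe, PNat.mul_coe, PNat.mul_coe]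
    have h1 := m.pos
    have h2 := M.pos
    have h3 : ((2 : ℕ+) : ℕ) = 2 := rfl
    nlinarith
  -- As `M > K`, the growth `ω((B + d) r + B) / (2 m M)` is at most `ω(r) / (2 m)` plus a constant.
  -- It uses up half of the decay `ω(r) / m`; the other half ensures summability.
  refine ⟨2 * m * M, ⟨φ.1, DL1StepSubmodule.mono ω d hmn φ.2⟩, rfl,
    DL1Step.hasSum_of_hasSum_mderiv ?_ fun α x => hasSum_mderiv_packetStep ω m _ φ α x⟩
  refine Summable.of_nonneg_of_le (fun _ => norm_nonneg _) (fun κ => ?_)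
    ((summable_invOneAddNorm_latticePoint (d := d)).mul_left (C * ‖φ‖ * D * exp 1))
  refine (h ω ω m (2 * m * M) (latticePoint κ) φ).trans ?_
  set k := latticePoint κ
  have hDk := hD k
  set r := 2 * π * ‖k‖ / (B + d) with hr
  have hr0 : 0 ≤ r := by positivity
  have hrk : 2 * π * ‖k‖ + B = (B + d) * r + B := by
    rw [hr]
    field_simp
  have hw := ω.nonneg hr0
  have hexp : -(1 / (m : ℝ) * ω r) + 1 / ((2 * m * M : ℕ+) : ℝ) * ω (2 * π * ‖k‖ + B) ≤
      -(1 / ((2 * m : ℕ+) : ℝ) * ω r) + 1 := by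
    rw [hrk]
    push_cast
    have h1 : 1 / (2 * (m : ℝ) * M) * ω ((B + d) * r + B) ≤ 1 / (2 * (m : ℝ) * M) * (M * ω r + M) := by
      gcongr
      exact (hωK r hr0).trans (by nlinarith)
    have h2 : 1 / (2 * (m : ℝ) * M) * (M * ω r + M) = 1 / (2 * m) * ω r + 1 / (2 * m) := by
      field_simp
    have h3 : 1 / (2 * (m : ℝ)) ≤ 1 := by
      have : (1 : ℝ) ≤ m := by exact_mod_cast m.pos
      rw [div_le_one (by positivity)]
      linarith
    have h4 : 1 / (m : ℝ) * ω r = 1 / (2 * m) * ω r + 1 / (2 * m) * ω r := by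
      field_simp
      norm_num
    linarith
  calc C * ‖φ‖ * (max 1 r * exp (-(1 / (m : ℝ) * ω r))) *
        exp (1 / ((2 * m * M : ℕ+) : ℝ) * ω (2 * π * ‖k‖ + B))
      = C * ‖φ‖ * max 1 r * exp (-(1 / (m : ℝ) * ω r) +
          1 / ((2 * m * M : ℕ+) : ℝ) * ω (2 * π * ‖k‖ + B)) := by
        rw [exp_add]
        ring
    _ ≤ C * ‖φ‖ * max 1 r * exp (-(1 / ((2 * m : ℕ+) : ℝ) * ω r) + 1) := by gcongr
    _ = C * ‖φ‖ * exp 1 * ((2 * π * ‖k‖ + B) ^ 0 *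
          (max 1 r * exp (-(1 / ((2 * m : ℕ+) : ℝ) * ω r)))) := by
        rw [exp_add]
        ring
    _ ≤ C * ‖φ‖ * exp 1 * (D * invOneAddNorm (d + 1) k) := by gcongr
    _ = _ := by ring

end Packets

end

/-! ### Choice of the smaller weight and extension of the functional -/

noncomputable section

section Extension

open Real

variable {d : ℕ}

/-- A continuous functional on `𝓓_{L¹,{ω}}` is small on wave packets of elements of
`𝓓_{L¹,{σ}}` for some `σ = o(ω)`. -/
theorem exists_norm_apply_packetStep_le (ω : WeightFunction) (f : BoundedInfrahyperfunction ω d) :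
    ∃ σ : WeightFunction, σ.toFun =o[atTop] ω.toFun ∧ ∀ m : ℕ+, ∃ D : ℝ, ∀ (φ : DL1Step σ d m)
      (κ : Fin d → ℤ),
        ‖f (DL1.ofStep ω d 1 (packetStep σ ω 1 (latticePoint κ) (DL1.ofStep σ d m φ)))‖ ≤
          D * ‖φ‖ * invOneAddNorm (d + 1) (latticePoint κ) := by
  choose Cf hCf0 hCf using DL1.exists_norm_ofStep_le f
  obtain ⟨C, B, hC, hB, hpacket⟩ := exists_norm_packetStep_le d
  have hBd : 0 < B + d := by positivity
  obtain ⟨K, hK, hωK⟩ := ω.exists_affine_le hBd.le (zero_le_one.trans hB)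
  have hn : ∀ n : ℕ+, (0 : ℝ) < n := fun n => by exact_mod_cast n.pos
  have hlog : ∀ n, 0 ≤ log (1 + Cf n) := fun n => log_nonneg (by linarith [hCf0 n])
  set a : ℕ+ → ℝ → ℝ := fun n t => log (1 + Cf n) + 1 / (n : ℝ) * (K * ω t + K) with ha
  have ha0 : ∀ n t, 0 ≤ t → 0 ≤ a n t := fun n t ht => by
    have := ω.nonneg ht
    have := hlog n
    have := hn n
    positivity
  have hbdd : ∀ t, 0 ≤ t → BddBelow (Set.range fun n => a n t) := fun t ht =>
    ⟨0, by rintro _ ⟨n, rfl⟩; exact ha0 n t ht⟩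
  set h : ℝ → ℝ := fun t => ⨅ n, a n t with hh
  have hm : MonotoneOn h (Set.Ici 0) := fun s hs t ht hst => ciInf_mono (hbdd s hs) fun n => by
    have := ω.monotone' hs ht hst
    have := hn n
    simp only [ha]
    gcongr
  have h0 : ∀ t, 0 ≤ t → 0 ≤ h t := fun t ht => le_ciInf fun n => ha0 n t ht
  have hlo : h =o[atTop] ω.toFun := by
    rw [isLittleO_iff]
    intro ε hε
    -- One fixed step already bounds the infimum: its slope `K / N` is below `ε / 2`, and its
    -- constant is absorbed as `ω` tends to infinity.
    obtain ⟨N, hN⟩ := exists_nat_gt (2 * K / ε)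
    have hN0 : 0 < N := by
      have : (0 : ℝ) < N := lt_trans (by positivity) hN
      exact_mod_cast this
    lift N to ℕ+ using hN0
    rw [div_lt_iff₀ hε] at hN
    filter_upwards [eventually_ge_atTop 0,
      ω.tendsto_atTop.eventually_ge_atTop ((log (1 + Cf N) + 1 / (N : ℝ) * K) / (ε / 2))] with t ht h1
    have hw := ω.nonneg ht
    rw [div_le_iff₀ (by positivity)] at h1
    rw [norm_of_nonneg (h0 t ht), norm_of_nonneg hw]
    have h2 : 1 / (N : ℝ) * K ≤ ε / 2 := by
      rw [one_div, inv_mul_le_iff₀ (hn N)]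
      linarith
    calc h t ≤ a N t := ciInf_le (hbdd t ht) N
      _ = 1 / (N : ℝ) * K * ω t + (log (1 + Cf N) + 1 / (N : ℝ) * K) := by
        simp only [ha]
        ring
      _ ≤ ε / 2 * ω t + ω t * (ε / 2) := by gcongr
      _ = ε * ω t := by ring
  obtain ⟨σ, hσω, hσ⟩ := ω.exists_isLittleO hm h0 hlo
  refine ⟨σ, hσω, fun m => ?_⟩
  have hm0 := hn m
  -- The choice `2 * m` spends half of the decay `σ / m` on `h` and saves the other half for
  -- summability.
  obtain ⟨c, hc⟩ : ∃ c, ∀ t, 0 ≤ t → h t ≤ 1 / ((2 * m : ℕ+) : ℝ) * σ t + c := by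
    obtain ⟨T, hT⟩ := eventually_atTop.1 ((isLittleO_iff.1 hσ)
      (c := 1 / ((2 * m : ℕ+) : ℝ)) (one_div_pos.2 (hn _)))
    refine ⟨h |T|, fun t ht => ?_⟩
    have hs := σ.nonneg ht
    have hs' : 0 ≤ 1 / ((2 * m : ℕ+) : ℝ) * σ t := mul_nonneg (one_div_pos.2 (hn _)).le hs
    rcases le_total T t with h1 | h1
    · have h2 := hT t h1
      rw [norm_of_nonneg (h0 t ht), norm_of_nonneg hs] at h2
      linarith [h0 |T| (abs_nonneg T)]
    · have h2 := hm ht (abs_nonneg T) (h1.trans (le_abs_self T))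
      linarith
  obtain ⟨D, hD0, hD⟩ := exists_freq_le_invOneAddNorm d hB σ (2 * m) 0
  refine ⟨C * exp (c + 1) * D, fun φ κ => ?_⟩
  set k := latticePoint κ
  have hDk := hD k
  set r := 2 * π * ‖k‖ / (B + d) with hr
  have hr0 : 0 ≤ r := by positivity
  have hrk : 2 * π * ‖k‖ + B = (B + d) * r + B := by
    rw [hr]
    field_simp
  -- The nearly optimal step `n` depends on the lattice point, whereas the final bound does not.
  obtain ⟨n, hnr⟩ := exists_lt_of_ciInf_lt (lt_add_one (h r))
  have hexp : log (1 + Cf n) + (-(1 / (m : ℝ) * σ r) + 1 / (n : ℝ) * ω (2 * π * ‖k‖ + B)) ≤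
      -(1 / ((2 * m : ℕ+) : ℝ) * σ r) + (c + 1) := by
    have h1 : 1 / (n : ℝ) * ω (2 * π * ‖k‖ + B) ≤ 1 / (n : ℝ) * (K * ω r + K) := by
      rw [hrk]
      exact mul_le_mul_of_nonneg_left (hωK r hr0) (one_div_pos.2 (hn n)).le
    have h2 : 1 / (m : ℝ) * σ r =
        1 / ((2 * m : ℕ+) : ℝ) * σ r + 1 / ((2 * m : ℕ+) : ℝ) * σ r := by
      push_cast
      field_simp
      norm_num
    have h3 := hc r hr0
    simp only [ha] at hnr
    linarith
  rw [ofStep_packetStep σ ω 1 n]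
  have hCn : 0 < 1 + Cf n := by linarith [hCf0 n]
  calc ‖f (DL1.ofStep ω d n (packetStep σ ω n k (DL1.ofStep σ d m φ)))‖
      ≤ Cf n * ‖packetStep σ ω n k (DL1.ofStep σ d m φ)‖ := hCf n _
    _ ≤ (1 + Cf n) * (C * ‖φ‖ * (max 1 r * exp (-(1 / (m : ℝ) * σ r))) *
          exp (1 / (n : ℝ) * ω (2 * π * ‖k‖ + B))) :=
        mul_le_mul (by linarith) (hpacket σ ω m n k φ) (norm_nonneg _) hCn.le
    _ = C * ‖φ‖ * max 1 r *
          exp (log (1 + Cf n) + (-(1 / (m : ℝ) * σ r) + 1 / (n : ℝ) * ω (2 * π * ‖k‖ + B))) := by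
        rw [exp_add, exp_add, exp_log hCn]
        ring
    _ ≤ C * ‖φ‖ * max 1 r * exp (-(1 / ((2 * m : ℕ+) : ℝ) * σ r) + (c + 1)) := by gcongr
    _ = C * ‖φ‖ * exp (c + 1) * ((2 * π * ‖k‖ + B) ^ 0 *
          (max 1 r * exp (-(1 / ((2 * m : ℕ+) : ℝ) * σ r)))) := by
        rw [exp_add]
        ring
    _ ≤ C * ‖φ‖ * exp (c + 1) * (D * invOneAddNorm (d + 1) k) := by gcongr
    _ = _ := by ring

theorem coe_ofStep (ω : WeightFunction) (n : ℕ+) (φ : DL1Step ω d n) :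
    (DL1.ofStep ω d n φ).1 = φ.1 := rfl

theorem coe_inclusion {ω σ : WeightFunction} (h : σ.toFun =O[atTop] ω.toFun) (φ : DL1 ω d) :
    (DL1.inclusion h d φ).1 = φ.1 :=
  Submodule.coe_inclusion (p := DL1Submodule ω d) (p' := DL1Submodule σ d)
    (fun _ ⟨n, hn⟩ => (DL1StepSubmodule.exists_le h d n).imp fun _ hk => hk hn) φ

theorem coe_packetStep (σ ω : WeightFunction) (n : ℕ+) (k : EuclideanSpace ℝ (Fin d))
    (φ : DL1 σ d) : (packetStep σ ω n k φ).1 = wavePacket (cubeWindow d) k φ.1 := rfl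

theorem ofStep_packetStep_inclusion {ω σ : WeightFunction} (h : σ.toFun =O[atTop] ω.toFun)
    (n m : ℕ+) (k : EuclideanSpace ℝ (Fin d)) (φ : DL1 ω d) :
    DL1.ofStep ω d n (packetStep σ ω n k (DL1.inclusion h d φ)) =
      DL1.ofStep ω d m (packetStep ω ω m k φ) :=
  Subtype.ext <| by rw [coe_ofStep, coe_ofStep, coe_packetStep, coe_packetStep, coe_inclusion]

end Extension

end

theorem mainTheorem4 (d : ℕ) (ω : WeightFunction) (f : BoundedInfrahyperfunction ω d) :
    ∃ (σ : WeightFunction) (hσ : σ.toFun =o[atTop] ω.toFun) (g : BoundedInfrahyperfunction σ d),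
      ∀ φ : DL1 ω d, g (DL1.inclusion hσ.isBigO d φ) = f φ := by
  obtain ⟨σ, hσ, hf⟩ := exists_norm_apply_packetStep_le ω f
  refine ⟨σ, hσ, ?_⟩
  have hstep : ∀ φ : DL1 σ d, ∃ (m : ℕ+) (θ : DL1Step σ d m), DL1.ofStep σ d m θ = φ :=
    fun φ => ⟨φ.2.choose, ⟨φ.1, φ.2.choose_spec⟩, rfl⟩
  have hv := summable_invOneAddNorm_latticePoint (d := d)
  -- Step `1` is an arbitrary choice: the packet lies in every step and has the same image in the
  -- inductive limit.
  let T : (Fin d → ℤ) → DL1 σ d →ₗ[ℂ] ℂ := fun κ =>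
    f.toLinearMap ∘ₗ DL1.ofStep ω d 1 ∘ₗ packetStep σ ω 1 (latticePoint κ)
  have hT : ∀ φ, Summable fun κ => T κ φ := by
    intro φ
    obtain ⟨m, θ, rfl⟩ := hstep φ
    obtain ⟨D, hD⟩ := hf m
    exact Summable.of_norm_bounded (hv.mul_left (D * ‖θ‖)) fun κ => hD θ κ
  let g : DL1 σ d →ₗ[ℂ] ℂ :=
    { toFun := fun φ => ∑' κ, T κ φ
      map_add' := fun φ θ => by
        simp only [map_add]
        exact (hT φ).tsum_add (hT θ)
      map_smul' := fun c φ => by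
        simp only [map_smul, smul_eq_mul, RingHom.id_apply]
        exact tsum_mul_left }
  have hg : Continuous g := by
    refine DL1.continuous_of_norm_ofStep_le g fun m => ?_
    obtain ⟨D, hD⟩ := hf m
    refine ⟨D * ∑' κ : Fin d → ℤ, invOneAddNorm (d + 1) (latticePoint κ), fun θ => ?_⟩
    refine (tsum_of_norm_bounded (hv.mul_left (D * ‖θ‖)).hasSum fun κ => hD θ κ).trans_eq ?_
    rw [tsum_mul_left]
    ring
  refine ⟨⟨g, hg⟩, fun φ => ?_⟩
  obtain ⟨m, θ, rfl⟩ : ∃ (m : ℕ+) (θ : DL1Step ω d m), DL1.ofStep ω d m θ = φ :=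
    ⟨φ.2.choose, ⟨φ.1, φ.2.choose_spec⟩, rfl⟩
  -- On the original space the expansion converges in a single step `n`, so continuity of `f` there
  -- lets `f` pass through the sum.
  obtain ⟨n, θ', hθ', hsum⟩ := exists_hasSum_packetStep ω m θ
  have h : HasSum (fun κ => f (DL1.ofStep ω d n (packetStep ω ω n (latticePoint κ)
      (DL1.ofStep ω d m θ)))) (f (DL1.ofStep ω d n θ')) :=
    hsum.map ((f : DL1 ω d →+ ℂ).comp (DL1.ofStep ω d n).toAddMonoidHom)
      (f.continuous.comp (DL1.continuous_ofStep n))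
  rw [hθ'] at h
  refine Eq.trans (tsum_congr fun κ => ?_) h.tsum_eq
  exact congrArg f (ofStep_packetStep_inclusion hσ.isBigO 1 n (latticePoint κ) _)
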